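/- Let $\theta>0$ and let $\star$ be the Moyal product on Schwartz functions on $\mathbb R^{1,1}$ (coordinates $x_0,x_1$, Lebesgue measure), $$(f\star g)(x)=\frac1{(\pi\theta)^2}\int d^2y\,d^2z\; f(x+y)\,g(x+z)\,e^{-2i\,y^\mu\Theta^{-1}_{\mu\nu}z^\nu},\qquad \Theta=\theta\begin{pmatrix}0&1\\-1&0\end{pmatrix},$$ extended by duality to products of tempered distributions with Schwartz functions: $\langle a\star b,g\rangle=\langle a,b\star g\rangle$ and $\langle b\star a,g\rangle=\langle a,g\star b\rangle$. Let $\mathcal M=\{a\in\mathcal S' : a\star b,\ b\star a\in\mathcal S\ \ \forall b\in\mathcal S\}$ be the multiplier algebra, and let $\widetilde{\mathbb A}\subset\mathcal M$ be a unitization of $(\mathcal S,\star)$, i.e. a unital $*$-subalgebra of $\mathcal M$ (involution: complex conjugation) that contains $\mathcal S$. With $z=\frac1{\sqrt2}(x_0+ix_1)$ and $f_{00}=2e^{-\frac2\theta\bar zz}$, let $$f_{mn}=\frac1{\sqrt{\theta^{m+n}m!\,n!}}\;\bar z^{\star m}\star f_{00}\star z^{\star n}\qquad(m,n\in\mathbb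 N)$$ be the matrix basis; the matrix coefficients of $a\in\mathcal S'$ are $a_{mn}=\frac1{2\pi\theta}\langle a,\overline{f_{mn}}\rangle$ (bilinear pairing). Let $\partial_\pm=\partial_0\pm\partial_1$ and $\lambda=\frac{1+i}{\sqrt2}$. On $\mathcal H_0=L^2(\mathbb R^{1,1})\otimes\mathbb C^2$ let $D=-i\partial_\mu\otimes\gamma^\mu$ with $\gamma^0=\begin{pmatrix}0&i\\i&0\end{pmatrix}$, $\gamma^1=\begin{pmatrix}0&i\\-i&0\end{pmatrix}$, let $\mathcal J=i\gamma^0$ and, for $a\in\mathcal M$, let $\pi(a)\psi=(a\star\psi_1,a\star\psi_2)$. The operator $\mathcal J[D,\pi(a)]$ is defined on $\mathcal S\otimes\mathbb C^2$ and is understood as the closure of this restriction (the bounded extension to all of $\mathcal H_0$ when it is bounded). The causal cone $\mathcal C$ is the set of all Hermitian $a\in\widetilde{\mathbb A}$ with $\langle\phi,\mathcal J[D,\pi(a)]\phi\rangle\le0$ for all $\phi$ in the domain. Let $a\in\widetilde{\mathbb A}$, and let $(a_{mn})$, $(\alpha_{mn})$, $(\beta_{mn})$ be the matrix coefficients of $a$,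 $\partial_-a$, $\partial_+a$. Then $a=\sum_{mn}a_{mn}f_{mn}$, $\partial_-a=\sum_{mn}\alpha_{mn}f_{mn}$, $\partial_+a=\sum_{mn}\beta_{mn}f_{mn}$ (unconditional weak convergence in $\mathcal S'$), and: a) for all $m,n\in\mathbb N$ (terms with an index $-1$ being $0$), $$\alpha_{mn}=a_{m+1,n}\,\lambda\sqrt{\tfrac{m+1}\theta}+a_{m,n+1}\,\bar\lambda\sqrt{\tfrac{n+1}\theta}-a_{m-1,n}\,\bar\lambda\sqrt{\tfrac m\theta}-a_{m,n-1}\,\lambda\sqrt{\tfrac n\theta},$$ $$\beta_{mn}=a_{m+1,n}\,\bar\lambda\sqrt{\tfrac{m+1}\theta}+a_{m,n+1}\,\lambda\sqrt{\tfrac{n+1}\theta}-a_{m-1,n}\,\lambda\sqrt{\tfrac m\theta}-a_{m,n-1}\,\bar\lambda\sqrt{\tfrac n\theta};$$ b) $\langle\phi,\mathcal J[D,\pi(a)]\phi\rangle\le0$ for all $\phi$ in the domain of $\mathcal J[D,\pi(a)]$ if and only if the infinite matrices $(\alpha_{mn})$ and $(\beta_{mn})$ are positive semidefinite (i.e. Hermitian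 with $\sum_{mn}\bar v_m\alpha_{mn}v_n\ge0$ for all finitely supported $v$, and likewise for $\beta$). If $\mathcal J[D,\pi(a)]$ is bounded on $\mathcal S\otimes\mathbb C^2$ and $T$ is its bounded extension to $\mathcal H_0$, the same equivalence holds with the condition $\langle\phi,T\phi\rangle\le0$ for all $\phi\in\mathcal H_0$. Consequently $a\in\mathcal C$ if and only if $a$ is Hermitian and $(\alpha_{mn})$, $(\beta_{mn})$ are positive semidefinite. -/

import Mathlib

open MeasureTheory Complex
open scoped SchwartzMap LineDeriv ContDiff FourierTransform ComplexOrder ComplexConjugate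

namespace Moyal

/-! ### Preliminary facts: Gaussians and tensor products are Schwartz functions -/

theorem norm_iteratedFDeriv_cexp_comp_le {V : Type*} [NormedAddCommGroup V] [NormedSpace ℝ V]
    {q : V → ℝ} (hq : q.HasTemperateGrowth) (c : ℂ) (hc : ‖c‖ ≤ 1) (n : ℕ) :
    ∃ (k : ℕ) (C : ℝ), 0 ≤ C ∧ ∀ x, ‖iteratedFDeriv ℝ n (fun x => cexp (c * q x)) x‖ ≤
      C * Real.exp (c.re * q x) * (1 + ‖x‖) ^ k := by
  obtain ⟨k, C, hC, h⟩ := hq.norm_iteratedFDeriv_le_uniform n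
  have hder : ∀ i : ℕ, iteratedDeriv i (fun t : ℝ => cexp (c * t)) =
      fun t : ℝ => c ^ i * cexp (c * t) := by
    intro i
    induction i with
    | zero => simp
    | succ i ih =>
      rw [iteratedDeriv_succ, ih]
      funext t
      have h1 : HasDerivAt (fun t : ℝ => c * (t : ℂ)) (c * 1) t :=
        (HasDerivAt.ofReal_comp (hasDerivAt_id t)).const_mul c
      have := (h1.cexp.const_mul (c ^ i)).deriv
      rw [this]; ring
  refine ⟨k * n, n.factorial * (1 + C) ^ n, by positivity, fun x => ?_⟩
  have hg : ContDiff ℝ ∞ (fun t : ℝ => cexp (c * t)) :=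
    (contDiff_const.mul ofRealCLM.contDiff).cexp
  have key := norm_iteratedFDeriv_comp_le (𝕜 := ℝ) (g := fun t : ℝ => cexp (c * t)) (f := q)
    (n := n) hg hq.1 (mod_cast le_top) x (C := Real.exp (c.re * q x))
    (D := (1 + C) * (1 + ‖x‖) ^ k) (by
      intro i hi
      rw [norm_iteratedFDeriv_eq_norm_iteratedDeriv, hder, norm_mul, norm_pow, norm_exp]
      simp only [re_mul_ofReal]
      exact mul_le_of_le_one_left (Real.exp_pos _).le (pow_le_one₀ (norm_nonneg _) hc))
    (by
      intro i hi hin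
      calc _ ≤ C * (1 + ‖x‖) ^ k := h i hin x
        _ ≤ (1 + C) * (1 + ‖x‖) ^ k := by gcongr; simp
        _ ≤ _ := by
          apply le_self_pow₀ (one_le_mul_of_one_le_of_one_le (by simp [hC]) (by simp [one_le_pow₀]))
          grind)
  refine key.trans (le_of_eq ?_)
  rw [mul_pow, ← pow_mul]; ring

theorem hasTemperateGrowth_cexp_I {V : Type*} [NormedAddCommGroup V] [NormedSpace ℝ V]
    {q : V → ℝ} (hq : q.HasTemperateGrowth) :
    Function.HasTemperateGrowth (fun x => cexp (I * q x)) := by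
  refine ⟨(contDiff_const.mul (ofRealCLM.contDiff.comp hq.1)).cexp, fun n => ?_⟩
  obtain ⟨k, C, -, h⟩ := norm_iteratedFDeriv_cexp_comp_le hq I (by simp) n
  exact ⟨k, C, fun x => by simpa using h x⟩

theorem gauss_decay {V : Type*} [NormedAddCommGroup V] [InnerProductSpace ℝ V] {c : ℝ} (hc : 0 < c)
    (k n : ℕ) : ∃ C, ∀ x : V, ‖x‖ ^ k *
      ‖iteratedFDeriv ℝ n (fun x : V => cexp (-1 * ((c * ‖x‖ ^ 2 : ℝ) : ℂ))) x‖ ≤ C := by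
  have hq : Function.HasTemperateGrowth (fun x : V => c * ‖x‖ ^ 2) := by fun_prop
  obtain ⟨l, C, hC, h⟩ := norm_iteratedFDeriv_cexp_comp_le hq (-1) (by simp) n
  have hb : ∃ B, ∀ t : ℝ, 0 ≤ t → (1 + t) ^ (k + l) * Real.exp (-(c * t ^ 2)) ≤ B := by
    refine ⟨((k + l).factorial : ℝ) * Real.exp (1 + 1 / (4 * c)), fun t ht => ?_⟩
    have h1 := Real.pow_div_factorial_le_exp (1 + t) (by positivity) (k + l)
    rw [div_le_iff₀ (by positivity)] at h1
    calc _ ≤ (Real.exp (1 + t) * ((k + l).factorial : ℝ)) * Real.exp (-(c * t ^ 2)) := by gcongr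
      _ = ((k + l).factorial : ℝ) * Real.exp (1 + t - c * t ^ 2) := by
        have e : Real.exp (1 + t - c * t ^ 2) = Real.exp (1 + t) * Real.exp (-(c * t ^ 2)) := by
          rw [← Real.exp_add]; ring_nf
        rw [e]; ring
      _ ≤ _ := by
        gcongr
        have : 1 / (4 * c) - t + c * t ^ 2 = c * (t - 1 / (2 * c)) ^ 2 := by field_simp; ring
        have h2 : 0 ≤ c * (t - 1 / (2 * c)) ^ 2 := by positivity
        linarith
  obtain ⟨B, hB⟩ := hb
  refine ⟨C * B, fun x => ?_⟩
  have h3 : ‖x‖ ^ k ≤ (1 + ‖x‖) ^ k := by gcongr; simp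
  calc _ ≤ (1 + ‖x‖) ^ k * (C * Real.exp ((-1 : ℂ).re * (c * ‖x‖ ^ 2)) * (1 + ‖x‖) ^ l) := by
        gcongr; exact h x
    _ = C * ((1 + ‖x‖) ^ (k + l) * Real.exp (-(c * ‖x‖ ^ 2))) := by
        simp [pow_add]; ring
    _ ≤ _ := by gcongr; exact hB _ (norm_nonneg _)

theorem exists_tensor {V : Type*} [NormedAddCommGroup V] [InnerProductSpace ℝ V] (f g : 𝓢(V, ℂ)) :
    ∃ h : 𝓢(WithLp 2 (V × V), ℂ), ∀ p, h p = f p.fst * g p.snd := by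
  let L₁ : WithLp 2 (V × V) →L[ℝ] V :=
    (ContinuousLinearMap.fst ℝ V V).comp (WithLp.prodContinuousLinearEquiv 2 ℝ V V).toContinuousLinearMap
  let L₂ : WithLp 2 (V × V) →L[ℝ] V :=
    (ContinuousLinearMap.snd ℝ V V).comp (WithLp.prodContinuousLinearEquiv 2 ℝ V V).toContinuousLinearMap
  have hn : ∀ p : WithLp 2 (V × V), ‖p‖ ≤ ‖L₁ p‖ + ‖L₂ p‖ := by
    intro p
    have := WithLp.prod_norm_sq_eq_of_L2 p
    change ‖p‖ ≤ ‖p.fst‖ + ‖p.snd‖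
    nlinarith [norm_nonneg p, norm_nonneg p.fst, norm_nonneg p.snd]
  have aux : ∀ (L : WithLp 2 (V × V) →L[ℝ] V) (f : 𝓢(V, ℂ)) (k i : ℕ), ∃ C, 0 ≤ C ∧ ∀ p,
      ‖L p‖ ^ k * ‖iteratedFDeriv ℝ i (f ∘ L) p‖ ≤ C := by
    intro L f k i
    obtain ⟨C, hC⟩ := f.decay' k i
    have hC0 : 0 ≤ C := le_trans (by positivity) (hC 0)
    refine ⟨C * ‖L‖ ^ i, by positivity, fun p => ?_⟩
    rw [L.iteratedFDeriv_comp_right (f.smooth ⊤) p (i := i) (mod_cast le_top)]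
    have := (iteratedFDeriv ℝ i f (L p)).norm_compContinuousLinearMap_le (fun _ => L)
    simp only [Finset.prod_const, Finset.card_univ, Fintype.card_fin] at this
    calc _ ≤ ‖L p‖ ^ k * (‖iteratedFDeriv ℝ i f (L p)‖ * ‖L‖ ^ i) := by gcongr
      _ = (‖L p‖ ^ k * ‖iteratedFDeriv ℝ i f (L p)‖) * ‖L‖ ^ i := by ring
      _ ≤ _ := by gcongr; exact hC _
  have s1 : ContDiff ℝ ∞ (f ∘ L₁) := (f.smooth ⊤).comp L₁.contDiff
  have s2 : ContDiff ℝ ∞ (g ∘ L₂) := (g.smooth ⊤).comp L₂.contDiff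
  refine ⟨⟨fun p => (f ∘ L₁) p * (g ∘ L₂) p, s1.mul s2, fun k n => ?_⟩, fun p => rfl⟩
  choose A hA0 hA using aux L₁ f
  choose B hB0 hB using aux L₂ g
  refine ⟨∑ i ∈ Finset.range (n + 1), (n.choose i : ℝ) * (2 ^ k *
    (A k i * B 0 (n - i) + A 0 i * B k (n - i))), fun p => ?_⟩
  have h1 := norm_iteratedFDeriv_mul_le s1 s2 p (n := n) (mod_cast le_top)
  have h2 : ‖p‖ ^ k ≤ 2 ^ k * (‖L₁ p‖ ^ k + ‖L₂ p‖ ^ k) := by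
    have e1 : ‖p‖ ≤ 2 * max ‖L₁ p‖ ‖L₂ p‖ := by
      have := hn p; have := le_max_left ‖L₁ p‖ ‖L₂ p‖; have := le_max_right ‖L₁ p‖ ‖L₂ p‖
      linarith
    calc ‖p‖ ^ k ≤ (2 * max ‖L₁ p‖ ‖L₂ p‖) ^ k := by gcongr
      _ = 2 ^ k * (max ‖L₁ p‖ ‖L₂ p‖) ^ k := mul_pow _ _ _
      _ ≤ _ := by
        gcongr
        rcases max_choice ‖L₁ p‖ ‖L₂ p‖ with h | h <;> rw [h]
        · exact le_add_of_nonneg_right (by positivity)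
        · exact le_add_of_nonneg_left (by positivity)
  refine (mul_le_mul_of_nonneg_left h1 (by positivity)).trans ?_
  rw [Finset.mul_sum]
  calc _ = ∑ i ∈ Finset.range (n + 1), (n.choose i : ℝ) * (‖p‖ ^ k *
        (‖iteratedFDeriv ℝ i (f ∘ L₁) p‖ * ‖iteratedFDeriv ℝ (n - i) (g ∘ L₂) p‖)) :=
      Finset.sum_congr rfl fun i _ => by ring
    _ ≤ _ := by
      refine Finset.sum_le_sum fun i _ => mul_le_mul_of_nonneg_left ?_ (by positivity)
      have a0 := hA 0 i p
      have ak := hA k i p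
      have b0 := hB 0 (n - i) p
      have bk := hB k (n - i) p
      simp only [pow_zero, one_mul] at a0 b0
      have hX := norm_nonneg (iteratedFDeriv ℝ i (f ∘ L₁) p)
      have hY := norm_nonneg (iteratedFDeriv ℝ (n - i) (g ∘ L₂) p)
      generalize ‖iteratedFDeriv ℝ i (f ∘ L₁) p‖ = X at *
      generalize ‖iteratedFDeriv ℝ (n - i) (g ∘ L₂) p‖ = Y at *
      calc _ ≤ (2 ^ k * (‖L₁ p‖ ^ k + ‖L₂ p‖ ^ k)) * (X * Y) :=
            mul_le_mul_of_nonneg_right h2 (by positivity)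
        _ = 2 ^ k * ((‖L₁ p‖ ^ k * X) * Y + X * (‖L₂ p‖ ^ k * Y)) := by ring
        _ ≤ _ := mul_le_mul_of_nonneg_left (add_le_add
            (mul_le_mul ak b0 hY (hA0 _ _)) (mul_le_mul a0 bk (by positivity) (hA0 _ _)))
            (by positivity)

theorem exists_schwartz_twisted {V : Type*} [NormedAddCommGroup V] [InnerProductSpace ℝ V]
    [FiniteDimensional ℝ V] [MeasurableSpace V] [BorelSpace V] (J : V →L[ℝ] V)
    (hJ : Function.Injective J) (hskew : ∀ u v, inner ℝ u (J v) = -inner ℝ v (J u))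
    {κ : ℝ} (hκ : κ ≠ 0) (f g : 𝓢(V, ℂ)) :
    ∃ s : 𝓢(V, ℂ), ∀ x, s x = ∫ p : V × V, f (x + p.1) * g (x + p.2) *
      cexp (I * ((κ * inner ℝ p.1 (J p.2) : ℝ) : ℂ)) := by
  obtain ⟨h, hh⟩ := exists_tensor f g
  let e := WithLp.prodContinuousLinearEquiv 2 ℝ V V
  let L₁ : WithLp 2 (V × V) →L[ℝ] V := (ContinuousLinearMap.fst ℝ V V).comp e.toContinuousLinearMap
  let L₂ : WithLp 2 (V × V) →L[ℝ] V := (ContinuousLinearMap.snd ℝ V V).comp e.toContinuousLinearMap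
  let A : V →L[ℝ] WithLp 2 (V × V) := e.symm.toContinuousLinearMap.comp
    (((κ / (2 * Real.pi)) • J).prod (-((κ / (2 * Real.pi)) • J)))
  have hκ' : κ / (2 * Real.pi) ≠ 0 := div_ne_zero hκ (by positivity)
  have hup : ∃ (k : ℕ) (C : ℝ), ∀ x, ‖x‖ ≤ C * (1 + ‖A x‖) ^ k := by
    obtain ⟨K, -, hK⟩ := (J : V →ₗ[ℝ] V).injective_iff_antilipschitz.1 hJ
    refine ⟨1, K * |κ / (2 * Real.pi)|⁻¹, fun x => ?_⟩
    have h1 := hK.le_mul_dist x 0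
    simp only [map_zero, dist_zero_right, ContinuousLinearMap.coe_coe] at h1
    have h2 : |κ / (2 * Real.pi)| * ‖J x‖ ≤ ‖A x‖ := by
      rw [← Real.norm_eq_abs, ← norm_smul]
      have := WithLp.prod_norm_sq_eq_of_L2 (A x)
      change ‖(A x).fst‖ ≤ ‖A x‖
      nlinarith [norm_nonneg (A x), norm_nonneg (A x).fst, norm_nonneg (A x).snd]
    have h3 : 0 < |κ / (2 * Real.pi)| := abs_pos.2 hκ'
    have h4 : ‖J x‖ ≤ |κ / (2 * Real.pi)|⁻¹ * ‖A x‖ := by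
      rw [le_inv_mul_iff₀ h3]; exact h2
    calc ‖x‖ ≤ K * ‖J x‖ := h1
      _ ≤ K * (|κ / (2 * Real.pi)|⁻¹ * (1 + ‖A x‖)) := by
        gcongr; exact h4.trans (by gcongr; linarith)
      _ = _ := by ring
  let q : WithLp 2 (V × V) → ℝ := fun p => κ * innerSL ℝ (L₁ p) (J (L₂ p))
  have hq : q.HasTemperateGrowth :=
    (Function.HasTemperateGrowth.const κ).mul
      ((innerSL ℝ).bilinear_hasTemperateGrowth (𝕜 := ℝ) L₁.hasTemperateGrowth
        (J.comp L₂).hasTemperateGrowth)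
  refine ⟨SchwartzMap.compCLM ℂ A.hasTemperateGrowth hup
    (𝓕 (SchwartzMap.smulLeftCLM ℂ (fun p => cexp (I * q p)) h)), fun x => ?_⟩
  have : (volume : Measure (V × V)).IsAddLeftInvariant :=
    inferInstanceAs ((volume : Measure V).prod (volume : Measure V)).IsAddLeftInvariant
  rw [SchwartzMap.compCLM_apply, Function.comp_apply, SchwartzMap.fourier_coe, Real.fourier_eq,
    ← (WithLp.volume_preserving_toLp (U := V) (V := V)).integral_comp
      (MeasurableEquiv.toLp 2 (V × V)).measurableEmbedding,
    ← integral_add_left_eq_self _ ((x, x) : V × V)]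
  refine integral_congr_ae (Filter.Eventually.of_forall fun p => ?_)
  obtain ⟨y, z⟩ := p
  have hinner : inner ℝ (WithLp.toLp 2 ((x, x) + (y, z))) (A x) =
      κ / (2 * Real.pi) * (inner ℝ y (J x) - inner ℝ z (J x)) := by
    have : A x = WithLp.toLp 2 ((κ / (2 * Real.pi)) • J x, -((κ / (2 * Real.pi)) • J x)) := rfl
    rw [this, WithLp.prod_inner_apply]
    simp only [Prod.mk_add_mk, inner_add_left, inner_neg_right, real_inner_smul_right]
    ring
  have hqq : q (WithLp.toLp 2 ((x, x) + (y, z))) =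
      κ * (inner ℝ y (J x) - inner ℝ z (J x)) + κ * inner ℝ y (J z) := by
    have h0 : inner ℝ x (J x) = 0 := by have := hskew x x; linarith
    change κ * inner ℝ (x + y) (J (x + z)) = _
    rw [map_add, inner_add_left, inner_add_right, inner_add_right, h0, hskew x z]
    ring
  simp only []
  rw [SchwartzMap.smulLeftCLM_apply_apply (hasTemperateGrowth_cexp_I hq), hh, hinner, hqq,
    Circle.smul_def, Real.fourierChar_apply, smul_eq_mul, smul_eq_mul, ← mul_assoc, ← exp_add,
    mul_comm]
  change f (x + y) * g (x + z) * _ = _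
  congr 2
  push_cast
  field_simp
  ring

/-! ### The Moyal product -/

/-- The plane `ℝ²` (or `ℝ^{1,1}`) with coordinates `x 0`, `x 1` and Lebesgue measure. -/
abbrev Plane := EuclideanSpace ℝ (Fin 2)

/-- The constant antisymmetric matrix `Θ`. -/
noncomputable def Theta (θ : ℝ) : Matrix (Fin 2) (Fin 2) ℝ := θ • !![0, 1; -1, 0]

/-- The oscillating factor `exp(-2i y^μ (Θ⁻¹)_{μν} z^ν)`. -/
noncomputable def moyalPhase (θ : ℝ) (y z : Plane) : ℂ :=
  cexp (-2 * I * ((∑ μ, ∑ ν, y μ * (Theta θ)⁻¹ μ ν * z ν : ℝ) : ℂ))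

/-- `(f ⋆ g)(x) = (πθ)⁻² ∫ d²y d²z f(x+y) g(x+z) exp(-2i y^μ (Θ⁻¹)_{μν} z^ν)`. -/
noncomputable def moyalIntegral (θ : ℝ) (f g : Plane → ℂ) (x : Plane) : ℂ :=
  1 / ((Real.pi * θ) ^ 2 : ℝ) *
    ∫ p : Plane × Plane, f (x + p.1) * g (x + p.2) * moyalPhase θ p.1 p.2

theorem moyalPhase_eq {θ : ℝ} (hθ : θ ≠ 0) (y z : Plane) :
    moyalPhase θ y z = cexp (I * ((2 / θ * (y 0 * z 1 - y 1 * z 0) : ℝ) : ℂ)) := by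
  have h : (Theta θ)⁻¹ = !![0, -θ⁻¹; θ⁻¹, 0] := by
    apply Matrix.inv_eq_right_inv
    ext i j
    fin_cases i <;> fin_cases j <;> simp [Theta, Matrix.mul_apply, Fin.sum_univ_two, hθ]
  rw [moyalPhase, h]
  congr 1
  simp [Fin.sum_univ_two]
  ring

theorem exists_schwartz_moyal (θ : ℝ) (f g : 𝓢(Plane, ℂ)) :
    ∃ s : 𝓢(Plane, ℂ), ∀ x, s x = moyalIntegral θ f g x := by
  rcases eq_or_ne θ 0 with rfl | hθ
  · exact ⟨0, fun x => by simp [moyalIntegral]⟩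
  let J₀ : Plane →ₗ[ℝ] Plane :=
    { toFun := fun x => !₂[x 1, -x 0]
      map_add' := fun x y => by ext i; fin_cases i <;> simp; ring
      map_smul' := fun c x => by ext i; fin_cases i <;> simp }
  have hJ : ∀ x : Plane, J₀.toContinuousLinearMap x = !₂[x 1, -x 0] := fun x => rfl
  obtain ⟨s, hs⟩ := exists_schwartz_twisted J₀.toContinuousLinearMap
    (by
      rw [injective_iff_map_eq_zero]
      intro x hx
      rw [hJ] at hx
      ext i
      fin_cases i
      · simpa using congrArg (fun v : Plane => v 1) hx
      · simpa using congrArg (fun v : Plane => v 0) hx)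
    (by intro u v; simp [hJ, PiLp.inner_apply, Fin.sum_univ_two]; ring)
    (κ := 2 / θ) (by positivity) f g
  refine ⟨(1 / ((Real.pi * θ) ^ 2 : ℝ) : ℂ) • s, fun x => ?_⟩
  rw [moyalIntegral, smul_apply, smul_eq_mul, hs]
  congr 2
  funext p
  rw [moyalPhase_eq hθ]
  congr 4
  simp [hJ, PiLp.inner_apply, Fin.sum_univ_two]
  ring_nf; simp

/-- The Moyal product `f ⋆ g` of two Schwartz functions, as a Schwartz function. -/
noncomputable def moyalProd (θ : ℝ) (f g : 𝓢(Plane, ℂ)) : 𝓢(Plane, ℂ) where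
  toFun := moyalIntegral θ f g
  smooth' := by
    obtain ⟨s, hs⟩ := exists_schwartz_moyal θ f g
    rw [← (funext hs : (s : Plane → ℂ) = _)]
    exact s.smooth'
  decay' := by
    obtain ⟨s, hs⟩ := exists_schwartz_moyal θ f g
    rw [← (funext hs : (s : Plane → ℂ) = _)]
    exact s.decay'

theorem moyalProd_apply (θ : ℝ) (f g : 𝓢(Plane, ℂ)) (x : Plane) :
    moyalProd θ f g x = moyalIntegral θ f g x := rfl

theorem integrable_moyal (θ : ℝ) (f g : 𝓢(Plane, ℂ)) (x : Plane) :
    Integrable (fun p : Plane × Plane => f (x + p.1) * g (x + p.2) * moyalPhase θ p.1 p.2)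
      (volume : Measure (Plane × Plane)) := by
  have h : Integrable (fun p : Plane × Plane => f (x + p.1) * g (x + p.2))
      ((volume : Measure Plane).prod volume) :=
    (f.integrable.comp_add_left x).mul_prod (g.integrable.comp_add_left x)
  refine h.mul_bdd (c := 1) (Continuous.aestronglyMeasurable ?_)
    (Filter.Eventually.of_forall fun p => ?_)
  · unfold moyalPhase; fun_prop
  · rw [moyalPhase, norm_exp]
    simp [-ofReal_sum, mul_re]

theorem moyalProd_add_left (θ : ℝ) (f f' g : 𝓢(Plane, ℂ)) :
    moyalProd θ (f + f') g = moyalProd θ f g + moyalProd θ f' g := by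
  ext x
  simp only [moyalProd_apply, add_apply, moyalIntegral, add_mul]
  rw [integral_add (integrable_moyal θ f g x) (integrable_moyal θ f' g x), mul_add]

theorem moyalProd_add_right (θ : ℝ) (f g g' : 𝓢(Plane, ℂ)) :
    moyalProd θ f (g + g') = moyalProd θ f g + moyalProd θ f g' := by
  ext x
  simp only [moyalProd_apply, add_apply, moyalIntegral, add_mul, mul_add]
  rw [integral_add (integrable_moyal θ f g x) (integrable_moyal θ f g' x), mul_add]

theorem moyalProd_smul_left (θ : ℝ) (c : ℂ) (f g : 𝓢(Plane, ℂ)) :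
    moyalProd θ (c • f) g = c • moyalProd θ f g := by
  ext x
  simp only [moyalProd_apply, smul_apply, moyalIntegral, smul_eq_mul, mul_assoc]
  rw [integral_const_mul]; ring

/-! ### Products with tempered distributions and the multiplier algebra -/

/-- Tempered distributions on the plane. -/
abbrev Dist := 𝓢'(Plane, ℂ)

/-- A Schwartz function `f` seen as the tempered distribution `g ↦ ∫ f g`. -/
noncomputable abbrev toDist (f : 𝓢(Plane, ℂ)) : Dist :=
  SchwartzMap.toTemperedDistributionCLM Plane ℂ volume f

/-- `a ⋆ b = c` for a tempered distribution `a` and Schwartz functions `b`, `c`. The product is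
the one of distributions, `⟨a ⋆ b, g⟩ = ⟨a, b ⋆ g⟩` (because `∫ (a ⋆ b) g = ∫ a (b ⋆ g)` on
Schwartz functions). -/
def IsLeftProd (θ : ℝ) (a : Dist) (b c : 𝓢(Plane, ℂ)) : Prop :=
  ∀ g : 𝓢(Plane, ℂ), ∫ x, c x * g x = a (moyalProd θ b g)

/-- `b ⋆ a = c` for a tempered distribution `a` and Schwartz functions `b`, `c`:
`⟨b ⋆ a, g⟩ = ⟨a, g ⋆ b⟩`. -/
def IsRightProd (θ : ℝ) (b : 𝓢(Plane, ℂ)) (a : Dist) (c : 𝓢(Plane, ℂ)) : Prop :=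
  ∀ g : 𝓢(Plane, ℂ), ∫ x, c x * g x = a (moyalProd θ g b)

theorem integrable_mul_schwartz (f g : 𝓢(Plane, ℂ)) : Integrable (fun x => f x * g x) := by
  exact (SchwartzMap.pairing (ContinuousLinearMap.mul ℂ ℂ) f g).integrable

theorem eq_of_integral_eq {c d : 𝓢(Plane, ℂ)}
    (h : ∀ g : 𝓢(Plane, ℂ), ∫ x, c x * g x = ∫ x, d x * g x) : c = d := by
  have h1 : toDist c = toDist d := by
    ext g
    simpa [mul_comm] using h g
  rw [toDist, toDist, ← Lp.toTemperedDistribution_toLp_eq (p := 2),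
    ← Lp.toTemperedDistribution_toLp_eq (p := 2)] at h1
  have h2 := LinearMap.ker_eq_bot.1
    (Lp.ker_toTemperedDistributionCLM_eq_bot (F := ℂ) (μ := (volume : Measure Plane)) (p := 2)) h1
  exact SchwartzMap.injective_toLp 2 volume h2

theorem IsLeftProd.unique {θ : ℝ} {a : Dist} {b c d : 𝓢(Plane, ℂ)}
    (hc : IsLeftProd θ a b c) (hd : IsLeftProd θ a b d) : c = d :=
  eq_of_integral_eq fun g => (hc g).trans (hd g).symm

open Classical in
/-- `a ⋆ b` for a tempered distribution `a` and a Schwartz function `b`, when it is a Schwartz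
function (as it is for `a` in the multiplier algebra). -/
noncomputable def leftProd (θ : ℝ) (a : Dist) (b : 𝓢(Plane, ℂ)) : 𝓢(Plane, ℂ) :=
  if h : ∃ c, IsLeftProd θ a b c then h.choose else 0

open Classical in
/-- `b ⋆ a` for a tempered distribution `a` and a Schwartz function `b`, when it is a Schwartz
function (as it is for `a` in the multiplier algebra). -/
noncomputable def rightProd (θ : ℝ) (b : 𝓢(Plane, ℂ)) (a : Dist) : 𝓢(Plane, ℂ) :=
  if h : ∃ c, IsRightProd θ b a c then h.choose else 0

theorem leftProd_spec {θ : ℝ} {a : Dist} {b : 𝓢(Plane, ℂ)} (h : ∃ c, IsLeftProd θ a b c) :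
    IsLeftProd θ a b (leftProd θ a b) := by
  rw [leftProd, dif_pos h]
  exact h.choose_spec

theorem leftProd_eq {θ : ℝ} {a : Dist} {b c : 𝓢(Plane, ℂ)} (h : IsLeftProd θ a b c) :
    leftProd θ a b = c :=
  (leftProd_spec ⟨c, h⟩).unique h

/-- The multiplier algebra: all tempered distributions `a` with `a ⋆ b` and `b ⋆ a` Schwartz for
every Schwartz function `b`. -/
def multiplierAlgebra (θ : ℝ) : Submodule ℂ Dist where
  carrier := {a | ∀ b, (∃ c, IsLeftProd θ a b c) ∧ ∃ c, IsRightProd θ b a c}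
  zero_mem' b := ⟨⟨0, fun g => by simp⟩, ⟨0, fun g => by simp⟩⟩
  add_mem' := by
    intro a a' h h' b
    obtain ⟨⟨c, hc⟩, d, hd⟩ := h b
    obtain ⟨⟨c', hc'⟩, d', hd'⟩ := h' b
    refine ⟨⟨c + c', fun g => ?_⟩, ⟨d + d', fun g => ?_⟩⟩
    · simp only [add_apply, add_mul]
      rw [integral_add (integrable_mul_schwartz c g) (integrable_mul_schwartz c' g), hc g, hc' g]
    · simp only [add_apply, add_mul]
      rw [integral_add (integrable_mul_schwartz d g) (integrable_mul_schwartz d' g), hd g, hd' g]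
  smul_mem' := by
    intro r a h b
    obtain ⟨⟨c, hc⟩, d, hd⟩ := h b
    refine ⟨⟨r • c, fun g => ?_⟩, ⟨r • d, fun g => ?_⟩⟩
    · simp only [smul_apply, smul_eq_mul, mul_assoc]
      rw [integral_const_mul, hc g]
    · simp only [smul_apply, smul_eq_mul, mul_assoc]
      rw [integral_const_mul, hd g]

/-- Left multiplication `L(a) : b ↦ a ⋆ b` on Schwartz functions. -/
noncomputable def leftMul (θ : ℝ) (a : multiplierAlgebra θ) : Module.End ℂ 𝓢(Plane, ℂ) where
  toFun b := leftProd θ a b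
  map_add' b b' := by
    refine leftProd_eq fun g => ?_
    simp only [add_apply, add_mul]
    rw [integral_add (integrable_mul_schwartz _ g) (integrable_mul_schwartz _ g),
      leftProd_spec (a.2 b).1 g, leftProd_spec (a.2 b').1 g, moyalProd_add_left, map_add]
  map_smul' r b := by
    refine leftProd_eq fun g => ?_
    simp only [smul_apply, smul_eq_mul, mul_assoc, RingHom.id_apply]
    rw [integral_const_mul, leftProd_spec (a.2 b).1 g, moyalProd_smul_left, map_smul, smul_eq_mul]

/-- Complex conjugation of Schwartz functions. -/
noncomputable def conjS (f : 𝓢(Plane, ℂ)) : 𝓢(Plane, ℂ) :=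
  SchwartzMap.postcompCLM (conjCLE : ℂ ≃L[ℝ] ℂ).toContinuousLinearMap f

theorem conjS_apply (f : 𝓢(Plane, ℂ)) (x : Plane) : conjS f x = conj (f x) := rfl

/-- `b` is the complex conjugate of the distribution `a`: `⟨b, g⟩` is the conjugate of
`⟨a, conj g⟩`. -/
def IsConj (a b : Dist) : Prop := ∀ g : 𝓢(Plane, ℂ), b g = conj (a (conjS g))

/-- A distribution is Hermitian when it is its own complex conjugate. -/
def IsHermitian (a : Dist) : Prop := IsConj a a

/-- Unitizations of the Moyal algebra: unital `*`-subalgebras of the multiplier algebra that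
contain all Schwartz functions. (Left multiplication is faithful and multiplicative, so
`leftMul θ c = leftMul θ a * leftMul θ b` says `c = a ⋆ b`.) -/
structure IsUnitization (θ : ℝ) (A : Submodule ℂ (multiplierAlgebra θ)) : Prop where
  schwartz_mem : ∀ f : 𝓢(Plane, ℂ), ∃ a ∈ A, (a : Dist) = toDist f
  one_mem : ∃ a ∈ A, (a : Dist) = (volume : Measure Plane).toTemperedDistribution
  mul_mem : ∀ a ∈ A, ∀ b ∈ A, ∃ c ∈ A, leftMul θ c = leftMul θ a * leftMul θ b
  conj_mem : ∀ a ∈ A, ∃ b ∈ A, IsConj (a : Dist) (b : Dist)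

/-! ### The matrix basis -/

/-- The complex coordinate `z = (x₀ + i x₁) / √2`. -/
noncomputable def zCoord (x : Plane) : ℂ := (x 0 + I * x 1) / (Real.sqrt 2 : ℂ)

/-- The complex coordinate `z̄ = (x₀ - i x₁) / √2`. -/
noncomputable def zbarCoord (x : Plane) : ℂ := (x 0 - I * x 1) / (Real.sqrt 2 : ℂ)

theorem hasTemperateGrowth_coord (i : Fin 2) :
    Function.HasTemperateGrowth (fun x : Plane => (x i : ℂ)) :=
  (ofRealCLM ∘L (EuclideanSpace.proj i : Plane →L[ℝ] ℝ)).hasTemperateGrowth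

theorem hasTemperateGrowth_zCoord : Function.HasTemperateGrowth zCoord := by
  have h := ((hasTemperateGrowth_coord 0).add
    ((Function.HasTemperateGrowth.const I).mul (hasTemperateGrowth_coord 1))).mul
    (Function.HasTemperateGrowth.const ((Real.sqrt 2 : ℂ)⁻¹))
  exact h

theorem hasTemperateGrowth_zbarCoord : Function.HasTemperateGrowth zbarCoord := by
  have h := ((hasTemperateGrowth_coord 0).sub
    ((Function.HasTemperateGrowth.const I).mul (hasTemperateGrowth_coord 1))).mul
    (Function.HasTemperateGrowth.const ((Real.sqrt 2 : ℂ)⁻¹))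
  exact h

/-- `z` as a tempered distribution. -/
noncomputable def zDist : Dist :=
  hasTemperateGrowth_zCoord.toTemperedDistribution (volume : Measure Plane)

/-- `z̄` as a tempered distribution. -/
noncomputable def zbarDist : Dist :=
  hasTemperateGrowth_zbarCoord.toTemperedDistribution (volume : Measure Plane)

theorem ground_eq (θ : ℝ) (x : Plane) :
    cexp (-(2 / θ) * (zbarCoord x * zCoord x)) =
      cexp (-1 * ((1 / θ * ‖x‖ ^ 2 : ℝ) : ℂ)) := by
  have h2 : (Real.sqrt 2 : ℂ) * (Real.sqrt 2 : ℂ) = 2 := by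
    rw [← ofReal_mul, Real.mul_self_sqrt (by norm_num)]; norm_num
  have h3 : zbarCoord x * zCoord x = ((x 0 : ℂ) ^ 2 + (x 1 : ℂ) ^ 2) / 2 := by
    rw [zbarCoord, zCoord, div_mul_div_comm, h2]
    congr 1
    linear_combination (-(x 1 : ℂ) ^ 2) * I_sq
  rw [h3, EuclideanSpace.real_norm_sq_eq, Fin.sum_univ_two]
  congr 1
  push_cast
  ring

/-- The ground state `f₀₀ = 2 exp(-(2/θ) z̄ z)`. -/
noncomputable def ground {θ : ℝ} (hθ : 0 < θ) : 𝓢(Plane, ℂ) where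
  toFun x := 2 * cexp (-(2 / θ) * (zbarCoord x * zCoord x))
  smooth' := by
    simp only [ground_eq]
    have hq : Function.HasTemperateGrowth (fun x : Plane => 1 / θ * ‖x‖ ^ 2) := by fun_prop
    exact contDiff_const.mul (contDiff_const.mul (ofRealCLM.contDiff.comp hq.1)).cexp
  decay' k n := by
    simp only [ground_eq]
    have hq : Function.HasTemperateGrowth (fun x : Plane => 1 / θ * ‖x‖ ^ 2) := by fun_prop
    have hs : ContDiff ℝ n (fun x : Plane => cexp (-1 * ((1 / θ * ‖x‖ ^ 2 : ℝ) : ℂ))) :=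
      (contDiff_const.mul (ofRealCLM.contDiff.comp
        (hq.1.of_le (mod_cast le_top)))).cexp
    obtain ⟨C, hC⟩ := gauss_decay (V := Plane) (one_div_pos.2 hθ) k n
    refine ⟨2 * C, fun x => ?_⟩
    have h := iteratedFDeriv_const_smul_apply (𝕜 := ℝ) (i := n) (a := (2 : ℂ)) (x := x)
      hs.contDiffAt
    have h' : (fun x : Plane => (2 : ℂ) * cexp (-1 * ((1 / θ * ‖x‖ ^ 2 : ℝ) : ℂ))) =
        (2 : ℂ) • fun x : Plane => cexp (-1 * ((1 / θ * ‖x‖ ^ 2 : ℝ) : ℂ)) := rfl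
    rw [h', h, norm_smul]
    have := hC x
    simp only [RCLike.norm_ofNat]
    linarith

/-- The matrix basis `f_mn = (θ^(m+n) m! n!)^(-1/2) z̄^⋆m ⋆ f₀₀ ⋆ z^⋆n`. -/
noncomputable def matrixBasis {θ : ℝ} (hθ : 0 < θ) (m n : ℕ) : 𝓢(Plane, ℂ) :=
  (1 / (Real.sqrt (θ ^ (m + n) * m.factorial * n.factorial) : ℂ)) •
    (leftProd θ zbarDist)^[m] ((fun f => rightProd θ f zDist)^[n] (ground hθ))

/-- The coefficients `a_mn = (2πθ)⁻¹ ⟨f_mn, a⟩ = (2πθ)⁻¹ ∫ conj(f_mn) a` of a distribution `a` in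
the matrix basis. -/
noncomputable def coeffMatrix {θ : ℝ} (hθ : 0 < θ) (a : Dist) : Matrix ℕ ℕ ℂ :=
  Matrix.of fun m n => 1 / ((2 * Real.pi * θ : ℝ) : ℂ) * a (conjS (matrixBasis hθ m n))

/-- `a = ∑ c_mn f_mn`, with convergence in the space of tempered distributions. -/
def IsExpansion {θ : ℝ} (hθ : 0 < θ) (c : Matrix ℕ ℕ ℂ) (a : Dist) : Prop :=
  HasSum (fun p : ℕ × ℕ => c p.1 p.2 • toDist (matrixBasis hθ p.1 p.2)) a

/-! ### The Lorentzian Dirac operator and the causal cone -/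

/-- The coordinate direction `e_μ`. -/
noncomputable def dir (μ : Fin 2) : Plane := EuclideanSpace.single μ 1

/-- `∂₋ a = ∂₀ a - ∂₁ a`. -/
noncomputable def partialMinus (a : Dist) : Dist := ∂_{dir 0} a - ∂_{dir 1} a

/-- `∂₊ a = ∂₀ a + ∂₁ a`. -/
noncomputable def partialPlus (a : Dist) : Dist := ∂_{dir 0} a + ∂_{dir 1} a

/-- Schwartz spinors, the common core of all operators below. -/
abbrev SchwartzSpinor := Fin 2 → 𝓢(Plane, ℂ)

/-- The Hilbert space `L²(ℝ^{1,1}) ⊗ ℂ²`. -/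
abbrev SpinorSpace := PiLp 2 (fun _ : Fin 2 => Lp ℂ 2 (volume : Measure Plane))

/-- The Dirac matrices `γ⁰ = iσ¹`, `γ¹ = σ²`. -/
noncomputable def gamma : Fin 2 → Matrix (Fin 2) (Fin 2) ℂ :=
  ![!![0, I; I, 0], !![0, I; -I, 0]]

/-- The operator `1 ⊗ M` for a `2 × 2` matrix `M`. -/
noncomputable def matOp (M : Matrix (Fin 2) (Fin 2) ℂ) : Module.End ℂ SchwartzSpinor :=
  LinearMap.pi fun i => ∑ j, M i j • LinearMap.proj j

/-- The operator `∂_μ ⊗ 1`. -/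
noncomputable def derivOp (μ : Fin 2) : Module.End ℂ SchwartzSpinor :=
  LinearMap.compLeft (LineDeriv.lineDerivOpCLM ℂ 𝓢(Plane, ℂ) (dir μ)).toLinearMap (Fin 2)

/-- The flat Dirac operator `D = -i ∂_μ ⊗ γ^μ`. -/
noncomputable def dirac : Module.End ℂ SchwartzSpinor :=
  (-I) • ∑ μ, derivOp μ * matOp (gamma μ)

/-- The fundamental symmetry `J = iγ⁰`. -/
noncomputable def fundSymm : Module.End ℂ SchwartzSpinor := matOp (I • gamma 0)

/-- The representation `π(a) = L(a) ⊗ 1`. -/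
noncomputable def rep (θ : ℝ) (a : multiplierAlgebra θ) : Module.End ℂ SchwartzSpinor :=
  LinearMap.compLeft (leftMul θ a) (Fin 2)

/-- `J[D, π(a)] = J (D π(a) - π(a) D)` on Schwartz spinors. -/
noncomputable def causalCore (θ : ℝ) (a : multiplierAlgebra θ) : Module.End ℂ SchwartzSpinor :=
  fundSymm * (dirac * rep θ a - rep θ a * dirac)

/-- The inclusion of Schwartz spinors in the Hilbert space. -/
noncomputable def spinorEmb : SchwartzSpinor →ₗ[ℂ] SpinorSpace :=
  (WithLp.linearEquiv 2 ℂ (Fin 2 → Lp ℂ 2 (volume : Measure Plane))).symm.toLinearMap ∘ₗ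
    LinearMap.compLeft (SchwartzMap.toLpCLM ℂ ℂ 2 (volume : Measure Plane)).toLinearMap (Fin 2)

theorem spinorEmb_injective : Function.Injective spinorEmb := by
  intro φ ψ h
  funext i
  exact SchwartzMap.injective_toLp 2 volume (congrArg (fun v : SpinorSpace => v i) h)

/-- `J[D, π(a)]` as a closed operator in the Hilbert space: the closure of its restriction to
Schwartz spinors. If `[D, π(a)]` is bounded on Schwartz spinors, this is its bounded extension to
the whole Hilbert space. -/
noncomputable def causalOperator (θ : ℝ) (a : multiplierAlgebra θ) :
    SpinorSpace →ₗ.[ℂ] SpinorSpace :=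
  LinearPMap.closure
    { domain := LinearMap.range spinorEmb
      toFun := spinorEmb ∘ₗ causalCore θ a ∘ₗ
        (LinearEquiv.ofInjective spinorEmb spinorEmb_injective).symm.toLinearMap }

/-- The causality constraint `⟨φ, J[D, π(a)] φ⟩ ≤ 0` for all `φ` (on which `J[D, π(a)]` is
defined). -/
def CausalConstraint (θ : ℝ) (a : multiplierAlgebra θ) : Prop :=
  ∀ φ : (causalOperator θ a).domain,
    inner ℂ (φ : SpinorSpace) (causalOperator θ a φ) ≤ 0

/-- The cone `C` of all Hermitian elements of the unitization that satisfy the causality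
constraint. -/
def causalCone (θ : ℝ) (A : Submodule ℂ (multiplierAlgebra θ)) : Set (multiplierAlgebra θ) :=
  {a | a ∈ A ∧ IsHermitian (a : Dist) ∧ CausalConstraint θ a}

/-- `λ = (1 + i) / √2`. -/
noncomputable def lam : ℂ := (1 + I) / (Real.sqrt 2 : ℂ)

end Moyal
open Moyal

/-!
Left and right Moyal multiplication by `z` and `z̄` are first order differential operators with
polynomial coefficients (`leftProd_zbarDist`, `rightProd_zDist`), because in the twisted form of the
product (`moyalProd_eq_twisted`) the integral over one factor is a Fourier transform. The canonical
commutation relations then give the ladder relations for the matrix basis `f_mn`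
(`zOp_matrixBasis` and its companions). The coordinate derivatives are linear combinations of the
four ladder operators, so testing `∂₋ a` and `∂₊ a` against `f_nm` is the shift formula
(`coeffMatrix_partialMinus`, `coeffMatrix_partialPlus`).

The ladder relations also give biorthogonality (`pair_matrixBasis`). The basis is complete: if all
coefficients of a Schwartz function `g` vanish, then `f₀₀ g` is orthogonal to all polynomials, and
the exponential series shows that its Fourier transform is zero (`eq_zero_of_pair_matrixBasis`).
Completeness identifies `f₀₀ ⋆ f₀₀` with `f₀₀`, hence `f_mn ⋆ f_kl = δ_nk f_ml`
(`moyalProd_matrixBasis`). Each Schwartz seminorm grows polynomially along the basis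
(`polyGrowth_seminorm`) and the coefficients of a Schwartz function decay rapidly
(`exists_norm_coeffS_le`), so Schwartz functions are the sums of their expansions in the Schwartz
topology (`hasSum_matrixBasis`), and by duality tempered distributions are the weak sums of theirs
(`isExpansion_coeffMatrix`).

The operator `J[D, π(a)]` is minus the diagonal operator with entries left multiplication by `∂₋ a`
and by `∂₊ a` (`inner_spinorEmb_causalCore`), by the Leibniz rule. So the constraint on Schwartz
spinors says that `b = ∂₋ a` and `b = ∂₊ a` satisfy `⟨b, φ ⋆ φ̄⟩ ≥ 0` for all Schwartz `φ`. This is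
equivalent to positive semidefiniteness of the coefficient matrix
(`forall_apply_moyalProd_conjS_nonneg_iff`): on finite combinations of the `f_k0` the form
`⟨b, φ ⋆ φ̄⟩` is the quadratic form of the matrix, and for general `φ` it is the limit over square
truncations of the double series for `b`, each of which is a sum over the columns of `φ` of values
of that quadratic form. The constraint passes to the closure and to a bounded extension because
`⟨u, v⟩ ≤ 0` is a closed condition (`forall_inner_closure_le_zero_iff`,
`forall_inner_extension_iff`).
-/

namespace Moyal

/-! ### Ladder operators -/

/-- Multiplication by the coordinate `x i`. -/
noncomputable def coordMul (i : Fin 2) : Module.End ℂ 𝓢(Plane, ℂ) :=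
  (SchwartzMap.smulLeftCLM ℂ (fun x : Plane => (x i : ℂ))).toLinearMap

/-- The partial derivative `∂_i`. -/
noncomputable def coordDeriv (i : Fin 2) : Module.End ℂ 𝓢(Plane, ℂ) :=
  (LineDeriv.lineDerivOpCLM ℂ 𝓢(Plane, ℂ) (dir i)).toLinearMap

theorem coordMul_apply (i : Fin 2) (f : 𝓢(Plane, ℂ)) (x : Plane) :
    coordMul i f x = x i * f x :=
  SchwartzMap.smulLeftCLM_apply_apply (hasTemperateGrowth_coord i) f x

theorem coordDeriv_eq (i : Fin 2) (f : 𝓢(Plane, ℂ)) : coordDeriv i f = ∂_{dir i} f := rfl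

theorem coordDeriv_apply (i : Fin 2) (f : 𝓢(Plane, ℂ)) (x : Plane) :
    coordDeriv i f x = fderiv ℝ f x (dir i) :=
  SchwartzMap.lineDerivOp_apply_eq_fderiv _ _ _

theorem coordMul_comm (i j : Fin 2) (f : 𝓢(Plane, ℂ)) :
    coordMul i (coordMul j f) = coordMul j (coordMul i f) := by
  ext x
  simp only [coordMul_apply]
  ring

theorem coordDeriv_comm (i j : Fin 2) (f : 𝓢(Plane, ℂ)) :
    coordDeriv i (coordDeriv j f) = coordDeriv j (coordDeriv i f) := by
  ext x
  rw [coordDeriv_apply, coordDeriv_apply]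
  have key : ∀ i j : Fin 2, fderiv ℝ (coordDeriv j f) x (dir i) =
      fderiv ℝ (fderiv ℝ f) x (dir i) (dir j) := by
    intro i j
    have h : (coordDeriv j f : Plane → ℂ) = fun y => fderiv ℝ f y (dir j) :=
      funext fun y => coordDeriv_apply j f y
    have hd : DifferentiableAt ℝ (fderiv ℝ f) x :=
      (((f.smooth 2).fderiv_right (m := 1) (by norm_num)).differentiable (by norm_num)) x
    rw [h, fderiv_clm_apply hd (by fun_prop)]
    simp
  rw [key, key]
  have hs : IsSymmSndFDerivAt ℝ f x :=
    ((f.smooth 2).contDiffAt).isSymmSndFDerivAt (by simp)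
  exact hs.eq _ _

theorem coordDeriv_coordMul (i j : Fin 2) (f : 𝓢(Plane, ℂ)) :
    coordDeriv i (coordMul j f) =
      coordMul j (coordDeriv i f) + (if i = j then (1 : ℂ) else 0) • f := by
  ext x
  have h : (coordMul j f : Plane → ℂ) = (fun y : Plane => (y j : ℂ)) * f :=
    funext fun y => coordMul_apply j f y
  have h1 : HasFDerivAt (fun y : Plane => (y j : ℂ))
      (ofRealCLM ∘L (EuclideanSpace.proj j : Plane →L[ℝ] ℝ)) x :=
    (ofRealCLM ∘L (EuclideanSpace.proj j : Plane →L[ℝ] ℝ)).hasFDerivAt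
  have h2 := (h1.mul (f.hasFDerivAt x)).fderiv
  rw [add_apply, coordMul_apply, coordDeriv_apply, coordDeriv_apply, h, h2]
  by_cases hij : i = j
  · subst hij; simp [dir]
  · have : ¬ j = i := fun h => hij h.symm
    simp [dir, hij, this]

/-- The operator `z + (s/2) ∂_z̄`. For `s = θ` it is `f ↦ z ⋆ f`, for `s = -θ` it is
`f ↦ f ⋆ z`. -/
noncomputable def zOp (s : ℝ) : Module.End ℂ 𝓢(Plane, ℂ) :=
  ((Real.sqrt 2 : ℂ)⁻¹) • ((coordMul 0 + I • coordMul 1) +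
    (s / 2 : ℂ) • (coordDeriv 0 + I • coordDeriv 1))

/-- The operator `z̄ - (s/2) ∂_z`. For `s = θ` it is `f ↦ z̄ ⋆ f`, for `s = -θ` it is
`f ↦ f ⋆ z̄`. -/
noncomputable def zbarOp (s : ℝ) : Module.End ℂ 𝓢(Plane, ℂ) :=
  ((Real.sqrt 2 : ℂ)⁻¹) • ((coordMul 0 - I • coordMul 1) -
    (s / 2 : ℂ) • (coordDeriv 0 - I • coordDeriv 1))

theorem sqrt_two_inv_sq : ((Real.sqrt 2 : ℂ)⁻¹) * (Real.sqrt 2 : ℂ)⁻¹ = 1 / 2 := by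
  rw [← mul_inv, ← ofReal_mul, Real.mul_self_sqrt (by norm_num)]; norm_num

theorem zOp_zOp_comm (s t : ℝ) (f : 𝓢(Plane, ℂ)) : zOp s (zOp t f) = zOp t (zOp s f) := by
  simp only [zOp, LinearMap.smul_apply, LinearMap.add_apply, map_add, map_smul,
    coordDeriv_coordMul, coordMul_comm 1 0, coordDeriv_comm 1 0]
  simp
  match_scalars <;> ring_nf <;> simp only [I_sq] <;> ring

/-- The canonical commutation relation, for left (`s = θ`) and right (`s = -θ`) multiplications at
the same time; a left and a right multiplication commute. -/
theorem zOp_zbarOp (s t : ℝ) (f : 𝓢(Plane, ℂ)) :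
    zOp s (zbarOp t f) = zbarOp t (zOp s f) + ((s + t) / 2 : ℂ) • f := by
  simp only [zOp, zbarOp, LinearMap.smul_apply, LinearMap.add_apply, LinearMap.sub_apply, map_add,
    map_sub, map_smul, coordDeriv_coordMul, coordMul_comm 1 0, coordDeriv_comm 1 0]
  simp
  have h : ((Real.sqrt 2 : ℂ)⁻¹) ^ 2 = 1 / 2 := by rw [sq, sqrt_two_inv_sq]
  match_scalars <;> ring_nf <;> simp only [I_sq, h] <;> ring

/-- The bilinear pairing `∫ f g` of Schwartz functions. -/
noncomputable def pair (f g : 𝓢(Plane, ℂ)) : ℂ := ∫ x, f x * g x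

theorem toDist_apply (f g : 𝓢(Plane, ℂ)) : toDist f g = pair f g := by
  simp [pair, mul_comm]

theorem pair_comm (f g : 𝓢(Plane, ℂ)) : pair f g = pair g f := by
  simp [pair, mul_comm]

theorem pair_add_left (f f' g : 𝓢(Plane, ℂ)) : pair (f + f') g = pair f g + pair f' g := by
  simp only [← toDist_apply, map_add, add_apply]

theorem pair_smul_left (c : ℂ) (f g : 𝓢(Plane, ℂ)) : pair (c • f) g = c * pair f g := by
  simp only [← toDist_apply, map_smul, smul_apply, smul_eq_mul]

theorem pair_add_right (f g g' : 𝓢(Plane, ℂ)) : pair f (g + g') = pair f g + pair f g' := by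
  simp only [← toDist_apply, map_add]

theorem pair_smul_right (c : ℂ) (f g : 𝓢(Plane, ℂ)) : pair f (c • g) = c * pair f g := by
  simp only [← toDist_apply, map_smul, smul_eq_mul]

theorem pair_sub_left (f f' g : 𝓢(Plane, ℂ)) : pair (f - f') g = pair f g - pair f' g := by
  simp only [← toDist_apply, map_sub, sub_apply]

theorem pair_sub_right (f g g' : 𝓢(Plane, ℂ)) : pair f (g - g') = pair f g - pair f g' := by
  simp only [← toDist_apply, map_sub]

theorem pair_zero_right (f : 𝓢(Plane, ℂ)) : pair f 0 = 0 := by simp [pair]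

theorem pair_coordMul (i : Fin 2) (f g : 𝓢(Plane, ℂ)) :
    pair (coordMul i f) g = pair f (coordMul i g) := by
  simp only [pair, coordMul_apply]
  congr 1; ext x; ring

theorem pair_coordDeriv (i : Fin 2) (f g : 𝓢(Plane, ℂ)) :
    pair (coordDeriv i f) g = -pair f (coordDeriv i g) := by
  have := SchwartzMap.integral_mul_lineDerivOp_right_eq_neg_left f g (dir i) (μ := volume)
  rw [pair, pair]
  simp only [coordDeriv_eq]
  rw [this, neg_neg]

theorem pair_zOp (s : ℝ) (f g : 𝓢(Plane, ℂ)) : pair (zOp s f) g = pair f (zOp (-s) g) := by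
  simp only [zOp, LinearMap.smul_apply, LinearMap.add_apply, pair_smul_left, pair_add_left,
    pair_smul_right, pair_add_right, pair_coordMul, pair_coordDeriv]
  push_cast; ring

theorem pair_zbarOp (s : ℝ) (f g : 𝓢(Plane, ℂ)) :
    pair (zbarOp s f) g = pair f (zbarOp (-s) g) := by
  simp only [zbarOp, LinearMap.smul_apply, LinearMap.sub_apply, pair_smul_left, pair_sub_left,
    pair_smul_right, pair_sub_right, pair_coordMul, pair_coordDeriv]
  push_cast; ring

theorem conjS_conjS (f : 𝓢(Plane, ℂ)) : conjS (conjS f) = f := by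
  ext x; simp [conjS_apply]

theorem conjS_add (f g : 𝓢(Plane, ℂ)) : conjS (f + g) = conjS f + conjS g := by
  ext x; simp [conjS_apply]

theorem conjS_smul (c : ℂ) (f : 𝓢(Plane, ℂ)) : conjS (c • f) = conj c • conjS f := by
  ext x; simp [conjS_apply]

theorem conjS_coordMul (i : Fin 2) (f : 𝓢(Plane, ℂ)) :
    conjS (coordMul i f) = coordMul i (conjS f) := by
  ext x; simp [conjS_apply, coordMul_apply]

theorem conjS_coordDeriv (i : Fin 2) (f : 𝓢(Plane, ℂ)) :
    conjS (coordDeriv i f) = coordDeriv i (conjS f) := by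
  ext x
  rw [conjS_apply, coordDeriv_apply, coordDeriv_apply]
  have h : (conjS f : Plane → ℂ) =
      (conjCLE : ℂ ≃L[ℝ] ℂ).toContinuousLinearMap ∘ f := rfl
  rw [h, ((conjCLE : ℂ ≃L[ℝ] ℂ).toContinuousLinearMap.hasFDerivAt.comp x (f.hasFDerivAt x)).fderiv]
  rfl

theorem conjS_zOp (s : ℝ) (f : 𝓢(Plane, ℂ)) : conjS (zOp s f) = zbarOp (-s) (conjS f) := by
  simp only [zOp, zbarOp, LinearMap.smul_apply, LinearMap.add_apply, LinearMap.sub_apply,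
    conjS_add, conjS_smul, conjS_coordMul, conjS_coordDeriv, map_inv₀, conj_ofReal, conj_I,
    map_div₀, map_ofNat]
  push_cast
  module

theorem conjS_zbarOp (s : ℝ) (f : 𝓢(Plane, ℂ)) : conjS (zbarOp s f) = zOp (-s) (conjS f) := by
  rw [← conjS_conjS (zOp (-s) (conjS f)), conjS_zOp, conjS_conjS, neg_neg]


/-! ### Calculus of the Moyal product -/

/-- Reversing the order of the factors reverses the sign of `θ`; this turns every statement about
left factors into one about right factors. -/
theorem moyalProd_swap (θ : ℝ) (f g : 𝓢(Plane, ℂ)) : moyalProd θ f g = moyalProd (-θ) g f := by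
  ext x
  have h1 : (Theta (-θ))⁻¹ = -(Theta θ)⁻¹ := by
    rw [Theta, neg_smul, ← Theta]
    rcases eq_or_ne θ 0 with rfl | hθ
    · simp [Theta]
    · apply Matrix.inv_eq_right_inv
      rw [neg_mul_neg, Matrix.mul_nonsing_inv]
      simp [Theta, Matrix.det_fin_two, hθ]
  have h0 : ∀ μ ν : Fin 2, (Theta θ)⁻¹ μ ν = -(Theta θ)⁻¹ ν μ := by
    intro μ ν
    have h : (Theta θ)⁻¹.transpose = -(Theta θ)⁻¹ := by
      rw [Matrix.transpose_nonsing_inv, ← h1]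
      congr 1
      ext i j
      fin_cases i <;> fin_cases j <;> simp [Theta]
    have := congrFun (congrFun h ν) μ
    simpa using this
  have h2 : ∀ y z : Plane, moyalPhase θ y z = moyalPhase (-θ) z y := by
    intro y z
    rw [moyalPhase, moyalPhase, h1]
    congr 3
    rw [Finset.sum_comm]
    refine Finset.sum_congr rfl fun μ _ => Finset.sum_congr rfl fun ν _ => ?_
    rw [h0]; simp only [Matrix.neg_apply]; ring
  rw [moyalProd_apply, moyalProd_apply, moyalIntegral, moyalIntegral]
  congr 1
  · simp
  · change ∫ p, _ ∂(volume.prod volume) = ∫ p, _ ∂(volume.prod volume)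
    rw [← integral_prod_swap]
    refine integral_congr_ae (Filter.Eventually.of_forall fun p => ?_)
    simp only [Prod.fst_swap, Prod.snd_swap]
    rw [h2 p.2 p.1]; ring

theorem norm_moyalPhase (θ : ℝ) (y z : Plane) : ‖moyalPhase θ y z‖ = 1 := by
  rw [moyalPhase, norm_exp]
  simp [-ofReal_sum, mul_re]

/-- The clockwise rotation by a right angle. -/
noncomputable def rot : Plane ≃ₗᵢ[ℝ] Plane where
  toFun x := !₂[x 1, -x 0]
  invFun x := !₂[-x 1, x 0]
  map_add' x y := by ext i; fin_cases i <;> simp; ring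
  map_smul' c x := by ext i; fin_cases i <;> simp
  left_inv x := by ext i; fin_cases i <;> simp
  right_inv x := by ext i; fin_cases i <;> simp
  norm_map' x := by simp [EuclideanSpace.norm_eq, Fin.sum_univ_two, add_comm]

theorem rot_apply (x : Plane) : rot x = !₂[x 1, -x 0] := rfl

/-- The oscillating integral over the second factor of the Moyal product is a Fourier transform. -/
theorem integral_mul_moyalPhase {θ : ℝ} (hθ : θ ≠ 0) (g : 𝓢(Plane, ℂ)) (x y : Plane) :
    ∫ z, g (x + z) * moyalPhase θ y z =
      moyalPhase θ y (-x) * 𝓕 g ((Real.pi * θ)⁻¹ • rot y) := by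
  have h := integral_add_left_eq_self (μ := (volume : Measure Plane))
    (fun w => g w * moyalPhase θ y (w - x)) x
  simp only [add_sub_cancel_left] at h
  rw [h, SchwartzMap.fourier_coe, Real.fourier_eq, ← integral_const_mul]
  refine integral_congr_ae (Filter.Eventually.of_forall fun w => ?_)
  simp only [moyalPhase_eq hθ]
  rw [Circle.smul_def, Real.fourierChar_apply, smul_eq_mul, ← mul_assoc, ← exp_add, mul_comm]
  congr 2
  simp only [rot_apply, PiLp.inner_apply, Fin.sum_univ_two]
  simp
  have := Real.pi_ne_zero
  field_simp
  ring

theorem integrable_fourier_rot {θ : ℝ} (hθ : θ ≠ 0) (g : 𝓢(Plane, ℂ)) :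
    Integrable (fun y : Plane => 𝓕 g ((Real.pi * θ)⁻¹ • rot y)) := by
  have h : Integrable (fun y : Plane => 𝓕 g ((Real.pi * θ)⁻¹ • y)) :=
    (𝓕 g).integrable.comp_smul (inv_ne_zero (mul_ne_zero Real.pi_ne_zero hθ))
  exact (rot.measurePreserving.integrable_comp_emb
    rot.toHomeomorph.measurableEmbedding).2 h

theorem continuous_moyalPhase (θ : ℝ) {X : Type*} [TopologicalSpace X] {u v : X → Plane}
    (hu : Continuous u) (hv : Continuous v) : Continuous (fun p => moyalPhase θ (u p) (v p)) := by
  unfold moyalPhase; fun_prop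

theorem integrable_twisted {θ : ℝ} (hθ : θ ≠ 0) (f g : 𝓢(Plane, ℂ)) (x : Plane) :
    Integrable (fun y : Plane => f (x + y) *
      (moyalPhase θ y (-x) * 𝓕 g ((Real.pi * θ)⁻¹ • rot y))) := by
  have hc : Continuous (fun y : Plane => moyalPhase θ y (-x)) :=
    continuous_moyalPhase θ continuous_id continuous_const
  have hb : ∀ᵐ y : Plane, ‖moyalPhase θ y (-x)‖ ≤ 1 :=
    Filter.Eventually.of_forall fun y => le_of_eq (norm_moyalPhase θ y (-x))
  have h1 : Integrable (fun y : Plane => moyalPhase θ y (-x) *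
      𝓕 g ((Real.pi * θ)⁻¹ • rot y)) :=
    (integrable_fourier_rot hθ g).bdd_mul (c := 1) hc.aestronglyMeasurable hb
  have h2 : Continuous (fun y : Plane => f (x + y)) :=
    f.continuous.comp (continuous_const.add continuous_id)
  exact h1.bdd_mul (c := SchwartzMap.seminorm ℂ 0 0 f) h2.aestronglyMeasurable
    (Filter.Eventually.of_forall fun y => f.norm_le_seminorm ℂ _)

/-- The Moyal product as a twisted convolution of `f` with the Fourier transform of `g`. -/
theorem moyalProd_eq_twisted {θ : ℝ} (hθ : θ ≠ 0) (f g : 𝓢(Plane, ℂ)) (x : Plane) :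
    moyalProd θ f g x = 1 / ((Real.pi * θ) ^ 2 : ℝ) *
      ∫ y, f (x + y) * (moyalPhase θ y (-x) * 𝓕 g ((Real.pi * θ)⁻¹ • rot y)) := by
  rw [moyalProd_apply, moyalIntegral]
  congr 1
  have := integral_prod _ (integrable_moyal θ f g x)
  refine this.trans ?_
  refine integral_congr_ae (Filter.Eventually.of_forall fun y => ?_)
  simp only [mul_assoc]
  rw [integral_const_mul, integral_mul_moyalPhase hθ]

/-- `x₀ (f ⋆ g) = (x₀ f) ⋆ g - (iθ/2) f ⋆ ∂₁ g`: in the twisted form of the product the difference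
of `x₀` and `x₀ + y₀` becomes a derivative of `g`. -/
theorem coordMul_zero_moyalProd {θ : ℝ} (hθ : θ ≠ 0) (f g : 𝓢(Plane, ℂ)) :
    coordMul 0 (moyalProd θ f g) =
      moyalProd θ (coordMul 0 f) g - (I * θ / 2) • moyalProd θ f (coordDeriv 1 g) := by
  ext x
  rw [coordMul_apply, sub_apply, smul_apply, moyalProd_eq_twisted hθ, moyalProd_eq_twisted hθ,
    moyalProd_eq_twisted hθ, smul_eq_mul, mul_left_comm, mul_left_comm (I * θ / 2), ← mul_sub,
    ← integral_const_mul (x 0 : ℂ), ← integral_const_mul (I * θ / 2 : ℂ),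
    ← integral_sub (integrable_twisted hθ _ _ _) ((integrable_twisted hθ _ _ _).const_mul _)]
  congr 1
  refine integral_congr_ae (Filter.Eventually.of_forall fun y => ?_)
  have h : 𝓕 (coordDeriv 1 g) ((Real.pi * θ)⁻¹ • rot y) =
      -(2 * I / θ) * y 0 * 𝓕 g ((Real.pi * θ)⁻¹ • rot y) := by
    rw [coordDeriv_eq, SchwartzMap.fourier_lineDerivOp_eq, smul_apply,
      SchwartzMap.smulLeftCLM_apply_apply (by fun_prop)]
    generalize 𝓕 g ((Real.pi * θ)⁻¹ • rot y) = G
    simp [dir, rot_apply, inner_smul_left, PiLp.inner_apply]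
    have := Real.pi_ne_zero
    field_simp
  simp only [h, coordMul_apply, PiLp.add_apply, ofReal_add]
  have : (θ : ℂ) ≠ 0 := mod_cast hθ
  generalize 𝓕 g ((Real.pi * θ)⁻¹ • rot y) = G
  field_simp
  linear_combination (-y 0 * f (x + y) * G * moyalPhase θ y (-x)) * I_sq

/-- `x₁ (f ⋆ g) = (x₁ f) ⋆ g + (iθ/2) f ⋆ ∂₀ g`. -/
theorem coordMul_one_moyalProd {θ : ℝ} (hθ : θ ≠ 0) (f g : 𝓢(Plane, ℂ)) :
    coordMul 1 (moyalProd θ f g) =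
      moyalProd θ (coordMul 1 f) g + (I * θ / 2) • moyalProd θ f (coordDeriv 0 g) := by
  ext x
  rw [coordMul_apply, add_apply, smul_apply, moyalProd_eq_twisted hθ, moyalProd_eq_twisted hθ,
    moyalProd_eq_twisted hθ, smul_eq_mul, mul_left_comm, mul_left_comm (I * θ / 2), ← mul_add,
    ← integral_const_mul (x 1 : ℂ), ← integral_const_mul (I * θ / 2 : ℂ),
    ← integral_add (integrable_twisted hθ _ _ _) ((integrable_twisted hθ _ _ _).const_mul _)]
  congr 1
  refine integral_congr_ae (Filter.Eventually.of_forall fun y => ?_)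
  have h : 𝓕 (coordDeriv 0 g) ((Real.pi * θ)⁻¹ • rot y) =
      (2 * I / θ) * y 1 * 𝓕 g ((Real.pi * θ)⁻¹ • rot y) := by
    rw [coordDeriv_eq, SchwartzMap.fourier_lineDerivOp_eq, smul_apply,
      SchwartzMap.smulLeftCLM_apply_apply (by fun_prop)]
    generalize 𝓕 g ((Real.pi * θ)⁻¹ • rot y) = G
    simp [dir, rot_apply, inner_smul_left, PiLp.inner_apply]
    have := Real.pi_ne_zero
    field_simp
  simp only [h, coordMul_apply, PiLp.add_apply, ofReal_add]
  have : (θ : ℂ) ≠ 0 := mod_cast hθ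
  generalize 𝓕 g ((Real.pi * θ)⁻¹ • rot y) = G
  field_simp
  linear_combination (-y 1 * f (x + y) * G * moyalPhase θ y (-x)) * I_sq

/-- Schwartz decay, uniform under translations by vectors of bounded length. -/
theorem exists_norm_add_le (f : 𝓢(Plane, ℂ)) (R : ℝ) : ∃ C, 0 ≤ C ∧ ∀ v y : Plane, ‖v‖ ≤ R →
    ‖f (v + y)‖ ≤ C * (1 + ‖y‖) ^ (-3 : ℝ) := by
  let M := 2 ^ 3 * ((Finset.Iic (3, 0)).sup fun m => SchwartzMap.seminorm ℂ m.1 m.2) f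
  have hM : ∀ x, (1 + ‖x‖) ^ 3 * ‖f x‖ ≤ M := fun x => by
    simpa using SchwartzMap.one_add_le_sup_seminorm_apply (𝕜 := ℂ) (m := (3, 0)) le_rfl le_rfl f x
  have hM0 : 0 ≤ M := le_trans (by positivity) (hM 0)
  refine ⟨(1 + |R|) ^ 3 * M, by positivity, fun v y hv => ?_⟩
  have h1 : 1 + ‖y‖ ≤ (1 + |R|) * (1 + ‖v + y‖) := by
    have h2 : ‖y‖ ≤ ‖v + y‖ + ‖v‖ := by
      calc ‖y‖ = ‖(v + y) - v‖ := by simp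
        _ ≤ _ := norm_sub_le _ _
    have h3 : ‖v‖ ≤ |R| := hv.trans (le_abs_self R)
    nlinarith [norm_nonneg (v + y), abs_nonneg R]
  have h4 : (1 + ‖y‖) ^ (-3 : ℝ) = ((1 + ‖y‖) ^ 3)⁻¹ := by
    rw [Real.rpow_neg (by positivity)]; norm_cast
  rw [h4, ← div_eq_mul_inv, le_div_iff₀ (by positivity)]
  calc ‖f (v + y)‖ * (1 + ‖y‖) ^ 3 ≤ ‖f (v + y)‖ * ((1 + |R|) * (1 + ‖v + y‖)) ^ 3 := by gcongr
    _ = (1 + |R|) ^ 3 * ((1 + ‖v + y‖) ^ 3 * ‖f (v + y)‖) := by ring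
    _ ≤ _ := by gcongr; exact hM _

/-- The Leibniz rule, by differentiating the defining integral under the integral sign. -/
theorem coordDeriv_moyalProd (θ : ℝ) (i : Fin 2) (f g : 𝓢(Plane, ℂ)) :
    coordDeriv i (moyalProd θ f g) =
      moyalProd θ (coordDeriv i f) g + moyalProd θ f (coordDeriv i g) := by
  ext x
  let e : Plane := dir i
  have he : ‖e‖ = 1 := by simp [e, dir]
  let R : ℝ := ‖x‖ + 1
  have hR : ∀ t ∈ Metric.ball (0 : ℝ) 1, ‖x + t • e‖ ≤ R := by
    intro t ht
    have : |t| ≤ 1 := by simpa using (Metric.mem_ball.1 ht).le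
    calc ‖x + t • e‖ ≤ ‖x‖ + ‖t • e‖ := norm_add_le _ _
      _ ≤ R := by rw [norm_smul, he, mul_one]; simpa [R] using this
  obtain ⟨C₁, hC₁, h₁⟩ := exists_norm_add_le f R
  obtain ⟨C₂, hC₂, h₂⟩ := exists_norm_add_le g R
  obtain ⟨D₁, hD₁, k₁⟩ := exists_norm_add_le (coordDeriv i f) R
  obtain ⟨D₂, hD₂, k₂⟩ := exists_norm_add_le (coordDeriv i g) R
  have hw : Integrable (fun y : Plane => (1 + ‖y‖) ^ (-3 : ℝ)) :=
    integrable_one_add_norm (by simp; norm_num)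
  have hbound : Integrable (fun p : Plane × Plane => (D₁ * C₂ + C₁ * D₂) *
      ((1 + ‖p.1‖) ^ (-3 : ℝ) * (1 + ‖p.2‖) ^ (-3 : ℝ)))
      ((volume : Measure Plane).prod volume) := (hw.mul_prod hw).const_mul _
  have hder : ∀ (h : 𝓢(Plane, ℂ)) (y : Plane) (t : ℝ),
      HasDerivAt (fun t : ℝ => h (x + t • e + y)) (coordDeriv i h (x + t • e + y)) t := by
    intro h y t
    have h3 : HasDerivAt (fun t : ℝ => x + t • e + y) e t := by
      simpa using (((hasDerivAt_id t).smul_const e).const_add x).add_const y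
    rw [coordDeriv_apply]
    exact (h.hasFDerivAt _).comp_hasDerivAt t h3
  have key := (hasDerivAt_integral_of_dominated_loc_of_deriv_le
    (μ := (volume : Measure Plane).prod volume) (x₀ := (0 : ℝ)) (s := Metric.ball 0 1)
    (F := fun t p => f (x + t • e + p.1) * g (x + t • e + p.2) * moyalPhase θ p.1 p.2)
    (F' := fun t p => (coordDeriv i f (x + t • e + p.1) * g (x + t • e + p.2) +
      f (x + t • e + p.1) * coordDeriv i g (x + t • e + p.2)) * moyalPhase θ p.1 p.2)
    (bound := fun p => (D₁ * C₂ + C₁ * D₂) *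
      ((1 + ‖p.1‖) ^ (-3 : ℝ) * (1 + ‖p.2‖) ^ (-3 : ℝ)))
    (Metric.ball_mem_nhds 0 one_pos)
    (Filter.Eventually.of_forall fun t => (integrable_moyal θ f g _).aestronglyMeasurable)
    (integrable_moyal θ f g _)
    (by
      have h4 := (integrable_moyal θ (coordDeriv i f) g (x + (0 : ℝ) • e)).add
        (integrable_moyal θ f (coordDeriv i g) (x + (0 : ℝ) • e))
      refine h4.aestronglyMeasurable.congr (Filter.Eventually.of_forall fun p => ?_)
      simp only [Pi.add_apply]; ring)
    (Filter.Eventually.of_forall fun p t ht => by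
      have a1 := h₁ _ p.1 (hR t ht)
      have a2 := h₂ _ p.2 (hR t ht)
      have b1 := k₁ _ p.1 (hR t ht)
      have b2 := k₂ _ p.2 (hR t ht)
      rw [norm_mul, norm_moyalPhase, mul_one]
      refine (norm_add_le _ _).trans ?_
      rw [norm_mul, norm_mul]
      have w1 : 0 ≤ (1 + ‖p.1‖) ^ (-3 : ℝ) := by positivity
      have w2 : 0 ≤ (1 + ‖p.2‖) ^ (-3 : ℝ) := by positivity
      calc _ ≤ (D₁ * (1 + ‖p.1‖) ^ (-3 : ℝ)) * (C₂ * (1 + ‖p.2‖) ^ (-3 : ℝ)) +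
            (C₁ * (1 + ‖p.1‖) ^ (-3 : ℝ)) * (D₂ * (1 + ‖p.2‖) ^ (-3 : ℝ)) := by gcongr
        _ = _ := by ring)
    hbound
    (Filter.Eventually.of_forall fun p t _ =>
      ((hder f p.1 t).mul (hder g p.2 t)).mul_const _)).2
  have h5 : HasDerivAt (fun t : ℝ => moyalProd θ f g (x + t • e))
      (coordDeriv i (moyalProd θ f g) x) 0 := by
    have := hder (moyalProd θ f g) 0 0
    simpa using this
  have h6 := (key.const_mul (1 / ((Real.pi * θ) ^ 2 : ℝ) : ℂ)).unique h5
  rw [← h6, add_apply, moyalProd_apply, moyalProd_apply, moyalIntegral, moyalIntegral, ← mul_add,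
    ← integral_add (integrable_moyal θ _ _ x) (integrable_moyal θ _ _ x)]
  congr 1
  refine integral_congr_ae (Filter.Eventually.of_forall fun p => ?_)
  simp only [zero_smul, add_zero]
  ring

/-- In its twisted form the Moyal product is absolutely integrable over both variables, in
contrast to the defining double integral. -/
theorem integrable_twisted_prod {θ : ℝ} (hθ : θ ≠ 0) (f g : 𝓢(Plane, ℂ)) :
    Integrable (fun p : Plane × Plane => f (p.1 + p.2) *
      (moyalPhase θ p.2 (-p.1) * 𝓕 g ((Real.pi * θ)⁻¹ • rot p.2)))
      ((volume : Measure Plane).prod volume) := by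
  have hph : Continuous (fun p : Plane × Plane => moyalPhase θ p.2 (-p.1)) :=
    continuous_moyalPhase θ continuous_snd continuous_fst.neg
  have hi := integrable_fourier_rot hθ g
  have hfG := f.integrable (μ := volume).mul_prod hi
  -- the shear `(x, y) ↦ (x + y, y)` preserves the measure
  have hsh := ((measurePreserving_add_prod (volume : Measure Plane)
    (volume : Measure Plane)).integrable_comp hfG.aestronglyMeasurable).2 hfG
  have hb : ∀ᵐ p ∂((volume : Measure Plane).prod volume), ‖moyalPhase θ p.2 (-p.1)‖ ≤ 1 :=
    Filter.Eventually.of_forall fun p => le_of_eq (norm_moyalPhase θ p.2 (-p.1))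
  refine (hsh.mul_bdd (c := 1) hph.aestronglyMeasurable hb).congr
      (Filter.Eventually.of_forall fun p => ?_)
  simp only [Function.comp_apply]
  ring

theorem integral_twisted_left {θ : ℝ} (hθ : θ ≠ 0) (f : 𝓢(Plane, ℂ)) (c : ℂ) (y : Plane) :
    ∫ x, f (x + y) * (moyalPhase θ y (-x) * c) =
      c * 𝓕⁻ f ((Real.pi * θ)⁻¹ • rot y) := by
  have h := integral_add_right_eq_self (μ := (volume : Measure Plane))
    (fun w => f w * (moyalPhase θ y (-(w - y)) * c)) y
  simp only [add_sub_cancel_right] at h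
  rw [h, SchwartzMap.fourierInv_coe, Real.fourierInv_eq, ← integral_const_mul]
  refine integral_congr_ae (Filter.Eventually.of_forall fun w => ?_)
  simp only [moyalPhase_eq hθ]
  rw [Circle.smul_def, Real.fourierChar_apply, smul_eq_mul]
  have he : ∀ u v : ℂ, u = v → f w * (cexp u * c) = c * (cexp v * f w) := by
    rintro u _ rfl; ring
  refine he _ _ ?_
  simp only [rot_apply, PiLp.inner_apply, Fin.sum_univ_two]
  simp
  have := Real.pi_ne_zero
  field_simp
  ring

/-- The tracial property `∫ f ⋆ g = ∫ f g`. After integration over `x` the twisted form is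
`∫ 𝓕⁻¹ f · 𝓕 g`. -/
theorem integral_moyalProd {θ : ℝ} (hθ : θ ≠ 0) (f g : 𝓢(Plane, ℂ)) :
    ∫ x, moyalProd θ f g x = pair f g := by
  simp only [moyalProd_eq_twisted hθ]
  rw [integral_const_mul, integral_integral_swap (integrable_twisted_prod hθ f g)]
  simp only [integral_twisted_left hθ]
  have h7 := rot.measurePreserving.integral_comp rot.toHomeomorph.measurableEmbedding
    (fun y => 𝓕 g ((Real.pi * θ)⁻¹ • y) * 𝓕⁻ f ((Real.pi * θ)⁻¹ • y))
  have h8 := Measure.integral_comp_smul (volume : Measure Plane)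
    (fun y => 𝓕 g y * 𝓕⁻ f y) (Real.pi * θ)⁻¹
  have h9 := SchwartzMap.integral_fourier_mul_eq g (𝓕⁻ f)
  rw [FourierTransform.fourier_fourierInv_eq] at h9
  rw [h7, h8, h9, pair]
  simp only [finrank_euclideanSpace, Fintype.card_fin, inv_pow, inv_inv, abs_pow, sq_abs]
  rw [real_smul, ← mul_assoc, one_div, inv_mul_cancel₀, one_mul]
  · simp only [mul_comm]
  · have := Real.pi_ne_zero
    norm_cast
    positivity

theorem moyalProd_smul_right (θ : ℝ) (c : ℂ) (f g : 𝓢(Plane, ℂ)) :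
    moyalProd θ f (c • g) = c • moyalProd θ f g := by
  rw [moyalProd_swap, moyalProd_smul_left, ← moyalProd_swap]

theorem moyalProd_sub_left (θ : ℝ) (f f' g : 𝓢(Plane, ℂ)) :
    moyalProd θ (f - f') g = moyalProd θ f g - moyalProd θ f' g := by
  have := moyalProd_add_left θ (f - f') f' g
  rw [sub_add_cancel] at this
  rw [this, add_sub_cancel_right]

theorem moyalProd_sub_right (θ : ℝ) (f g g' : 𝓢(Plane, ℂ)) :
    moyalProd θ f (g - g') = moyalProd θ f g - moyalProd θ f g' := by
  rw [moyalProd_swap, moyalProd_sub_left, ← moyalProd_swap, ← moyalProd_swap]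

theorem zOp_moyalProd_left {θ : ℝ} (hθ : θ ≠ 0) (f g : 𝓢(Plane, ℂ)) :
    zOp θ (moyalProd θ f g) = moyalProd θ (zOp θ f) g := by
  simp only [zOp, LinearMap.smul_apply, LinearMap.add_apply, coordMul_zero_moyalProd hθ,
    coordMul_one_moyalProd hθ, coordDeriv_moyalProd, moyalProd_add_left, moyalProd_smul_left]
  match_scalars <;> ring_nf <;> simp only [I_sq] <;> ring

theorem zbarOp_moyalProd_left {θ : ℝ} (hθ : θ ≠ 0) (f g : 𝓢(Plane, ℂ)) :
    zbarOp θ (moyalProd θ f g) = moyalProd θ (zbarOp θ f) g := by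
  simp only [zbarOp, LinearMap.smul_apply, LinearMap.sub_apply, coordMul_zero_moyalProd hθ,
    coordMul_one_moyalProd hθ, coordDeriv_moyalProd, moyalProd_sub_left, moyalProd_smul_left]
  match_scalars <;> ring_nf <;> simp only [I_sq] <;> ring

theorem zOp_moyalProd_right {θ : ℝ} (hθ : θ ≠ 0) (f g : 𝓢(Plane, ℂ)) :
    zOp (-θ) (moyalProd θ f g) = moyalProd θ f (zOp (-θ) g) := by
  rw [moyalProd_swap, zOp_moyalProd_left (neg_ne_zero.2 hθ), ← moyalProd_swap]

theorem zbarOp_moyalProd_right {θ : ℝ} (hθ : θ ≠ 0) (f g : 𝓢(Plane, ℂ)) :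
    zbarOp (-θ) (moyalProd θ f g) = moyalProd θ f (zbarOp (-θ) g) := by
  rw [moyalProd_swap, zbarOp_moyalProd_left (neg_ne_zero.2 hθ), ← moyalProd_swap]

theorem zOp_sub_zOp_neg (s : ℝ) (f : 𝓢(Plane, ℂ)) :
    zOp s f - zOp (-s) f = (s * (Real.sqrt 2 : ℂ)⁻¹) • (coordDeriv 0 f + I • coordDeriv 1 f) := by
  simp only [zOp, LinearMap.smul_apply, LinearMap.add_apply]
  push_cast
  module

theorem zbarOp_sub_zbarOp_neg (s : ℝ) (f : 𝓢(Plane, ℂ)) :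
    zbarOp s f - zbarOp (-s) f =
      -((s * (Real.sqrt 2 : ℂ)⁻¹) • (coordDeriv 0 f - I • coordDeriv 1 f)) := by
  simp only [zbarOp, LinearMap.smul_apply, LinearMap.sub_apply]
  push_cast
  module

/-- `(f ⋆ z) ⋆ g = f ⋆ (z ⋆ g)`. -/
theorem moyalProd_zOp {θ : ℝ} (hθ : θ ≠ 0) (f g : 𝓢(Plane, ℂ)) :
    moyalProd θ (zOp (-θ) f) g = moyalProd θ f (zOp θ g) := by
  have h1 := zOp_sub_zOp_neg θ (moyalProd θ f g)
  have h2 := congrArg (fun h => moyalProd θ h g) (zOp_sub_zOp_neg θ f)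
  have h3 := congrArg (fun h => moyalProd θ f h) (zOp_sub_zOp_neg θ g)
  simp only [zOp_moyalProd_left hθ, zOp_moyalProd_right hθ, coordDeriv_moyalProd,
    moyalProd_sub_left, moyalProd_sub_right, moyalProd_smul_left, moyalProd_smul_right,
    moyalProd_add_left, moyalProd_add_right] at h1 h2 h3
  linear_combination (norm := module) h1 - h2 - h3

/-- `(f ⋆ z̄) ⋆ g = f ⋆ (z̄ ⋆ g)`. -/
theorem moyalProd_zbarOp {θ : ℝ} (hθ : θ ≠ 0) (f g : 𝓢(Plane, ℂ)) :
    moyalProd θ (zbarOp (-θ) f) g = moyalProd θ f (zbarOp θ g) := by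
  have h1 := zbarOp_sub_zbarOp_neg θ (moyalProd θ f g)
  have h2 := congrArg (fun h => moyalProd θ h g) (zbarOp_sub_zbarOp_neg θ f)
  have h3 := congrArg (fun h => moyalProd θ f h) (zbarOp_sub_zbarOp_neg θ g)
  rw [← neg_smul] at h1 h2 h3
  simp only [zbarOp_moyalProd_left hθ, zbarOp_moyalProd_right hθ, coordDeriv_moyalProd,
    moyalProd_sub_left, moyalProd_sub_right, moyalProd_smul_left, moyalProd_smul_right] at h1 h2 h3
  linear_combination (norm := module) h1 - h2 - h3

theorem integral_coordMul_zero_moyalProd {θ : ℝ} (hθ : θ ≠ 0) (f g : 𝓢(Plane, ℂ)) :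
    SchwartzMap.integralCLM ℂ volume (coordMul 0 (moyalProd θ f g)) =
      pair (coordMul 0 f + (I * θ / 2) • coordDeriv 1 f) g := by
  rw [coordMul_zero_moyalProd hθ, map_sub, map_smul, SchwartzMap.integralCLM_apply,
    SchwartzMap.integralCLM_apply, integral_moyalProd hθ, integral_moyalProd hθ, pair_add_left,
    pair_smul_left, pair_coordDeriv, smul_eq_mul]
  ring

theorem integral_coordMul_one_moyalProd {θ : ℝ} (hθ : θ ≠ 0) (f g : 𝓢(Plane, ℂ)) :
    SchwartzMap.integralCLM ℂ volume (coordMul 1 (moyalProd θ f g)) =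
      pair (coordMul 1 f - (I * θ / 2) • coordDeriv 0 f) g := by
  rw [coordMul_one_moyalProd hθ, map_add, map_smul, SchwartzMap.integralCLM_apply,
    SchwartzMap.integralCLM_apply, integral_moyalProd hθ, integral_moyalProd hθ, pair_sub_left,
    pair_smul_left, pair_coordDeriv, smul_eq_mul]
  ring

theorem zDist_apply (h : 𝓢(Plane, ℂ)) :
    zDist h = SchwartzMap.integralCLM ℂ volume
      ((Real.sqrt 2 : ℂ)⁻¹ • (coordMul 0 h + I • coordMul 1 h)) := by
  refine (Function.HasTemperateGrowth.toTemperedDistribution_apply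
    (volume : Measure Plane) hasTemperateGrowth_zCoord h).trans ?_
  rw [SchwartzMap.integralCLM_apply]
  congr 1
  ext x
  simp only [zCoord, smul_apply, add_apply, coordMul_apply, smul_eq_mul]
  ring

theorem zbarDist_apply (h : 𝓢(Plane, ℂ)) :
    zbarDist h = SchwartzMap.integralCLM ℂ volume
      ((Real.sqrt 2 : ℂ)⁻¹ • (coordMul 0 h - I • coordMul 1 h)) := by
  refine (Function.HasTemperateGrowth.toTemperedDistribution_apply
    (volume : Measure Plane) hasTemperateGrowth_zbarCoord h).trans ?_
  rw [SchwartzMap.integralCLM_apply]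
  congr 1
  ext x
  simp only [zbarCoord, smul_apply, sub_apply, coordMul_apply, smul_eq_mul]
  ring

/-- `z̄ ⋆ f` as a differential operator applied to `f`. -/
theorem leftProd_zbarDist {θ : ℝ} (hθ : θ ≠ 0) (f : 𝓢(Plane, ℂ)) :
    leftProd θ zbarDist f = zbarOp θ f := by
  refine leftProd_eq fun g => ?_
  rw [zbarDist_apply, map_smul, map_sub, map_smul, integral_coordMul_zero_moyalProd hθ,
    integral_coordMul_one_moyalProd hθ]
  change pair _ _ = _
  simp only [zbarOp, LinearMap.smul_apply, LinearMap.sub_apply, pair_smul_left, pair_sub_left,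
    pair_add_left, smul_eq_mul]
  ring_nf
  simp only [I_sq]
  ring

/-- `f ⋆ z` as a differential operator applied to `f`. -/
theorem rightProd_zDist {θ : ℝ} (hθ : θ ≠ 0) (f : 𝓢(Plane, ℂ)) :
    rightProd θ f zDist = zOp (-θ) f := by
  have hex : IsRightProd θ f zDist (zOp (-θ) f) := by
    intro g
    rw [moyalProd_swap, zDist_apply, map_smul, map_add, map_smul,
      integral_coordMul_zero_moyalProd (neg_ne_zero.2 hθ),
      integral_coordMul_one_moyalProd (neg_ne_zero.2 hθ)]
    change pair _ _ = _
    simp only [zOp, LinearMap.smul_apply, LinearMap.add_apply, pair_smul_left, pair_sub_left,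
      pair_add_left, smul_eq_mul]
    push_cast
    ring_nf
    simp only [I_sq]
    ring
  have h : ∃ c, IsRightProd θ f zDist c := ⟨_, hex⟩
  rw [rightProd, dif_pos h]
  exact eq_of_integral_eq fun g => (h.choose_spec g).trans (hex g).symm


/-! ### Ladder relations and biorthogonality of the matrix basis -/

theorem ofReal_sqrt_two_sq_inv : ((Real.sqrt 2 : ℂ) ^ 2)⁻¹ = 1 / 2 := by
  rw [← inv_pow, sq, sqrt_two_inv_sq]

theorem ground_apply {θ : ℝ} (hθ : 0 < θ) (x : Plane) :
    ground hθ x = 2 * cexp (-1 * ((1 / θ * ‖x‖ ^ 2 : ℝ) : ℂ)) :=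
  congrArg (2 * ·) (ground_eq θ x)

theorem ground_apply_real {θ : ℝ} (hθ : 0 < θ) (x : Plane) :
    ground hθ x = ((2 * Real.exp (-(1 / θ) * ‖x‖ ^ 2) : ℝ) : ℂ) := by
  rw [ground_apply]; push_cast; congr 2; ring

theorem coordDeriv_ground {θ : ℝ} (hθ : 0 < θ) (i : Fin 2) :
    coordDeriv i (ground hθ) = (-(2 / θ) : ℂ) • coordMul i (ground hθ) := by
  ext x
  rw [coordDeriv_apply, smul_apply, coordMul_apply]
  have h : (ground hθ : Plane → ℂ) = fun x =>
      (2 : ℂ) * cexp (((-(1 / θ) * ‖x‖ ^ 2 : ℝ) : ℂ)) := by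
    funext x; rw [ground_apply]; push_cast; congr 2; ring
  have h1 : HasFDerivAt (fun x : Plane => -(1 / θ) * ‖x‖ ^ 2) _ x :=
    (HasStrictFDerivAt.hasFDerivAt (hasStrictFDerivAt_norm_sq x)).const_mul (-(1 / θ))
  have h2 := ((ofRealCLM.hasFDerivAt.comp x h1).cexp.const_mul (2 : ℂ)).fderiv
  have h3 : (ground hθ : Plane → ℂ) = fun x =>
      (2 : ℂ) * cexp ((ofRealCLM ∘ fun x : Plane => -(1 / θ) * ‖x‖ ^ 2) x) := h
  rw [h3, h2]
  simp [dir, PiLp.inner_apply]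
  ring

theorem zOp_ground {θ : ℝ} (hθ : 0 < θ) : zOp θ (ground hθ) = 0 := by
  have : (θ : ℂ) ≠ 0 := mod_cast hθ.ne'
  simp only [zOp, LinearMap.smul_apply, LinearMap.add_apply, coordDeriv_ground]
  match_scalars <;> field_simp <;> ring

theorem zbarOp_neg_ground {θ : ℝ} (hθ : 0 < θ) : zbarOp (-θ) (ground hθ) = 0 := by
  have : (θ : ℂ) ≠ 0 := mod_cast hθ.ne'
  simp only [zbarOp, LinearMap.smul_apply, LinearMap.sub_apply, coordDeriv_ground]
  push_cast
  match_scalars <;> field_simp <;> ring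

theorem conjS_ground {θ : ℝ} (hθ : 0 < θ) : conjS (ground hθ) = ground hθ := by
  ext x
  rw [conjS_apply, ground_apply_real, conj_ofReal]

/-- The ladder coefficient `√(θ k)`. -/
noncomputable def lad (θ : ℝ) (k : ℕ) : ℂ := (Real.sqrt (θ * k) : ℂ)

theorem lad_zero (θ : ℝ) : lad θ 0 = 0 := by simp [lad]

theorem lad_succ_ne_zero {θ : ℝ} (hθ : 0 < θ) (k : ℕ) : lad θ (k + 1) ≠ 0 := by
  rw [lad, ofReal_ne_zero]
  have : 0 < θ * ((k + 1 : ℕ) : ℝ) := by positivity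
  exact (Real.sqrt_pos.2 this).ne'

theorem lad_mul_self {θ : ℝ} (hθ : 0 < θ) (k : ℕ) : lad θ k * lad θ k = θ * k := by
  rw [lad, ← ofReal_mul, Real.mul_self_sqrt (by positivity)]
  push_cast; rfl

section Basis

variable {θ : ℝ} (hθ : 0 < θ)

theorem matrixBasis_eq (m n : ℕ) : matrixBasis hθ m n =
    (1 / (Real.sqrt (θ ^ (m + n) * m.factorial * n.factorial) : ℂ)) •
      (zbarOp θ)^[m] ((zOp (-θ))^[n] (ground hθ)) := by
  have h1 : leftProd θ zbarDist = zbarOp θ := funext (leftProd_zbarDist hθ.ne')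
  have h2 : (fun f => rightProd θ f zDist) = zOp (-θ) := funext (rightProd_zDist hθ.ne')
  rw [matrixBasis, h1, h2]

theorem matrixBasis_zero_zero : matrixBasis hθ 0 0 = ground hθ := by
  simp [matrixBasis_eq]

/-- `z̄ ⋆ f_mn = √(θ(m+1)) f_{m+1,n}`. -/
theorem zbarOp_matrixBasis (m n : ℕ) :
    zbarOp θ (matrixBasis hθ m n) = lad θ (m + 1) • matrixBasis hθ (m + 1) n := by
  rw [matrixBasis_eq, matrixBasis_eq, map_smul, ← Function.iterate_succ_apply' (zbarOp θ), smul_smul]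
  congr 1
  have h : θ ^ (m + 1 + n) * (m + 1).factorial * n.factorial =
      (θ * (m + 1 : ℕ)) * (θ ^ (m + n) * m.factorial * n.factorial) := by
    rw [Nat.factorial_succ]; push_cast; ring
  have h0 : (Real.sqrt (θ ^ (m + n) * m.factorial * n.factorial) : ℂ) ≠ 0 := by
    rw [ofReal_ne_zero]
    exact (Real.sqrt_pos.2 (by positivity)).ne'
  have h1 := lad_succ_ne_zero hθ m
  have hs := Real.sqrt_mul (x := θ * (m + 1 : ℕ)) (by positivity)
    (θ ^ (m + n) * m.factorial * n.factorial)
  rw [h, hs, ofReal_mul]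
  rw [lad] at h1 ⊢
  generalize (Real.sqrt (θ ^ (m + n) * m.factorial * n.factorial) : ℂ) = u at h0
  field_simp

/-- `f_mn ⋆ z = √(θ(n+1)) f_{m,n+1}`. -/
theorem zOp_neg_matrixBasis (m n : ℕ) :
    zOp (-θ) (matrixBasis hθ m n) = lad θ (n + 1) • matrixBasis hθ m (n + 1) := by
  have hcomm : Function.Commute (zOp (-θ)) (zbarOp θ) := fun f => by
    rw [zOp_zbarOp]; simp
  rw [matrixBasis_eq, matrixBasis_eq, map_smul, (hcomm.iterate_right m).eq,
    ← Function.iterate_succ_apply' (zOp (-θ)), smul_smul]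
  congr 1
  have h : θ ^ (m + (n + 1)) * m.factorial * (n + 1).factorial =
      (θ * (n + 1 : ℕ)) * (θ ^ (m + n) * m.factorial * n.factorial) := by
    rw [Nat.factorial_succ]; push_cast; ring
  have h0 : (Real.sqrt (θ ^ (m + n) * m.factorial * n.factorial) : ℂ) ≠ 0 := by
    rw [ofReal_ne_zero]
    exact (Real.sqrt_pos.2 (by positivity)).ne'
  have h1 := lad_succ_ne_zero hθ n
  have hs := Real.sqrt_mul (x := θ * (n + 1 : ℕ)) (by positivity)
    (θ ^ (m + n) * m.factorial * n.factorial)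
  rw [h, hs, ofReal_mul]
  rw [lad] at h1 ⊢
  generalize (Real.sqrt (θ ^ (m + n) * m.factorial * n.factorial) : ℂ) = u at h0
  field_simp

theorem conjS_matrixBasis (m n : ℕ) : conjS (matrixBasis hθ m n) = matrixBasis hθ n m := by
  induction m generalizing n with
  | zero =>
    induction n with
    | zero => rw [matrixBasis_zero_zero, conjS_ground]
    | succ n ih =>
      apply smul_right_injective _ (lad_succ_ne_zero hθ n)
      simp only
      have h := conjS_zOp (-θ) (matrixBasis hθ 0 n)
      rw [neg_neg, ih, zOp_neg_matrixBasis, zbarOp_matrixBasis, conjS_smul, lad, conj_ofReal,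
        ← lad] at h
      exact h
  | succ m ih =>
    apply smul_right_injective _ (lad_succ_ne_zero hθ m)
    simp only
    rw [← zOp_neg_matrixBasis, ← ih, ← conjS_zbarOp, zbarOp_matrixBasis, conjS_smul, lad,
      conj_ofReal]

/-- `z ⋆ f_mn = √(θm) f_{m-1,n}`. -/
theorem zOp_matrixBasis (m n : ℕ) :
    zOp θ (matrixBasis hθ m n) = lad θ m • matrixBasis hθ (m - 1) n := by
  induction m with
  | zero =>
    rw [lad_zero, zero_smul]
    induction n with
    | zero => rw [matrixBasis_zero_zero, zOp_ground]
    | succ n ih =>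
      apply smul_right_injective _ (lad_succ_ne_zero hθ n)
      simp only
      rw [← map_smul, ← zOp_neg_matrixBasis, zOp_zOp_comm, ih, map_zero, smul_zero]
  | succ m ih =>
    apply smul_right_injective _ (lad_succ_ne_zero hθ m)
    simp only
    rw [← map_smul, ← zbarOp_matrixBasis, zOp_zbarOp, ih, map_smul, smul_smul, lad_mul_self hθ,
      Nat.add_sub_cancel]
    have h : lad θ m • zbarOp θ (matrixBasis hθ (m - 1) n) = (θ * m : ℂ) • matrixBasis hθ m n := by
      cases m with
      | zero => simp [lad_zero]
      | succ m => rw [Nat.add_sub_cancel, zbarOp_matrixBasis, smul_smul, lad_mul_self hθ]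
    rw [h]
    push_cast
    module

/-- `f_mn ⋆ z̄ = √(θn) f_{m,n-1}`. -/
theorem zbarOp_neg_matrixBasis (m n : ℕ) :
    zbarOp (-θ) (matrixBasis hθ m n) = lad θ n • matrixBasis hθ m (n - 1) := by
  rw [← conjS_matrixBasis, ← conjS_zOp, zOp_matrixBasis, conjS_smul, conjS_matrixBasis, lad,
    conj_ofReal]

theorem pair_matrixBasis_succ_left (m n : ℕ) (g : 𝓢(Plane, ℂ)) :
    lad θ (m + 1) * pair (matrixBasis hθ (m + 1) n) g =
      pair (matrixBasis hθ m n) (zbarOp (-θ) g) := by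
  rw [← pair_smul_left, ← zbarOp_matrixBasis, pair_zbarOp]

theorem pair_matrixBasis_succ_right (m n : ℕ) (g : 𝓢(Plane, ℂ)) :
    lad θ (n + 1) * pair (matrixBasis hθ m (n + 1)) g =
      pair (matrixBasis hθ m n) (zOp θ g) := by
  rw [← pair_smul_left, ← zOp_neg_matrixBasis, pair_zOp, neg_neg]

theorem integral_ground : ∫ x, ground hθ x = 2 * Real.pi * θ := by
  simp only [ground_apply_real]
  rw [integral_complex_ofReal, integral_const_mul,
    GaussianFourier.integral_rexp_neg_mul_sq_norm (by positivity)]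
  simp
  ring

theorem pair_ground_ground : pair (ground hθ) (ground hθ) = 2 * Real.pi * θ := by
  have h : ∀ x, ground hθ x * ground hθ x =
      ((4 * Real.exp (-(2 / θ) * ‖x‖ ^ 2) : ℝ) : ℂ) := by
    intro x
    rw [ground_apply_real, ← ofReal_mul]
    have : Real.exp (-(2 / θ) * ‖x‖ ^ 2) =
        Real.exp (-(1 / θ) * ‖x‖ ^ 2) * Real.exp (-(1 / θ) * ‖x‖ ^ 2) := by
      rw [← Real.exp_add]; ring_nf
    rw [this]; ring_nf
  simp only [pair, h]
  rw [integral_complex_ofReal, integral_const_mul,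
    GaussianFourier.integral_rexp_neg_mul_sq_norm (by positivity)]
  have : (θ : ℂ) ≠ 0 := mod_cast hθ.ne'
  simp
  field_simp
  norm_num

/-- Biorthogonality: `∫ f_mn f_kl = 2πθ δ_ml δ_nk`. -/
theorem pair_matrixBasis (m n k l : ℕ) : pair (matrixBasis hθ m n) (matrixBasis hθ k l) =
    if m = l ∧ n = k then (2 * Real.pi * θ : ℂ) else 0 := by
  induction m generalizing l with
  | zero =>
    induction n generalizing k with
    | zero =>
      rcases k with _ | k
      · rcases l with _ | l
        · simp [matrixBasis_zero_zero, pair_ground_ground]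
        · apply mul_left_cancel₀ (lad_succ_ne_zero hθ l)
          rw [pair_comm, pair_matrixBasis_succ_right, zOp_matrixBasis, lad_zero]
          simp [pair_zero_right]
      · apply mul_left_cancel₀ (lad_succ_ne_zero hθ k)
        rw [pair_comm, pair_matrixBasis_succ_left, zbarOp_neg_matrixBasis, lad_zero]
        simp [pair_zero_right]
    | succ n ih =>
      apply mul_left_cancel₀ (lad_succ_ne_zero hθ n)
      rw [pair_matrixBasis_succ_right, zOp_matrixBasis, pair_smul_right, ih]
      rcases k with _ | k
      · simp [lad_zero]
      · rw [Nat.add_sub_cancel]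
        by_cases h : 0 = l ∧ n = k
        · obtain ⟨rfl, rfl⟩ := h; simp
        · rw [if_neg h, if_neg (by omega)]; simp
  | succ m ih =>
    apply mul_left_cancel₀ (lad_succ_ne_zero hθ m)
    rw [pair_matrixBasis_succ_left, zbarOp_neg_matrixBasis, pair_smul_right, ih]
    rcases l with _ | l
    · simp [lad_zero]
    · rw [Nat.add_sub_cancel]
      by_cases h : m = l ∧ n = k
      · obtain ⟨rfl, rfl⟩ := h; simp
      · rw [if_neg h, if_neg (by omega)]; simp

/-- `f_mn ⋆ f_kl = δ_nk f_ml`, given the case `m = n = k = l = 0`. -/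
theorem moyalProd_matrixBasis_of_ground
    (h0 : moyalProd θ (ground hθ) (ground hθ) = ground hθ) (m n k l : ℕ) :
    moyalProd θ (matrixBasis hθ m n) (matrixBasis hθ k l) =
      if n = k then matrixBasis hθ m l else 0 := by
  have hz : ∀ g, moyalProd θ g 0 = 0 := fun g => by
    simpa using moyalProd_smul_right θ 0 g 0
  have hz' : ∀ g, moyalProd θ 0 g = 0 := fun g => by
    simpa using moyalProd_smul_left θ 0 0 g
  induction n generalizing k with
  | zero =>
    rcases k with _ | k
    · rw [if_pos rfl]
      induction m with
      | zero =>
        induction l with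
        | zero => rw [matrixBasis_zero_zero, h0]
        | succ l ih =>
          apply smul_right_injective _ (lad_succ_ne_zero hθ l)
          simp only
          rw [← moyalProd_smul_right, ← zOp_neg_matrixBasis, ← zOp_moyalProd_right hθ.ne', ih,
            zOp_neg_matrixBasis]
      | succ m ih =>
        apply smul_right_injective _ (lad_succ_ne_zero hθ m)
        simp only
        rw [← moyalProd_smul_left, ← zbarOp_matrixBasis, ← zbarOp_moyalProd_left hθ.ne', ih,
          zbarOp_matrixBasis]
    · rw [if_neg (by omega)]
      apply smul_right_injective _ (lad_succ_ne_zero hθ k)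
      simp only
      rw [← moyalProd_smul_right, ← zbarOp_matrixBasis, ← moyalProd_zbarOp hθ.ne',
        zbarOp_neg_matrixBasis, lad_zero, zero_smul, hz', smul_zero]
  | succ n ih =>
    apply smul_right_injective _ (lad_succ_ne_zero hθ n)
    simp only
    rw [← moyalProd_smul_left, ← zOp_neg_matrixBasis, moyalProd_zOp hθ.ne', zOp_matrixBasis,
      moyalProd_smul_right]
    rcases k with _ | k
    · simp [lad_zero]
    · rw [Nat.add_sub_cancel, ih]
      by_cases h : n = k
      · subst h; simp
      · simp [h]

end Basis

theorem coordMul_zero_eq (θ : ℝ) (f : 𝓢(Plane, ℂ)) :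
    coordMul 0 f = ((Real.sqrt 2 : ℂ)⁻¹ / 2) •
      (zOp θ f + zOp (-θ) f + zbarOp θ f + zbarOp (-θ) f) := by
  simp only [zOp, zbarOp, LinearMap.smul_apply, LinearMap.add_apply, LinearMap.sub_apply]
  push_cast
  match_scalars <;> ring_nf <;> simp [ofReal_sqrt_two_sq_inv]

theorem coordMul_one_eq (θ : ℝ) (f : 𝓢(Plane, ℂ)) :
    coordMul 1 f = (-I * (Real.sqrt 2 : ℂ)⁻¹ / 2) •
      (zOp θ f + zOp (-θ) f - zbarOp θ f - zbarOp (-θ) f) := by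
  simp only [zOp, zbarOp, LinearMap.smul_apply, LinearMap.add_apply, LinearMap.sub_apply]
  push_cast
  match_scalars <;> ring_nf <;> simp [ofReal_sqrt_two_sq_inv]

theorem coordDeriv_zero_eq {θ : ℝ} (hθ : θ ≠ 0) (f : 𝓢(Plane, ℂ)) :
    coordDeriv 0 f = ((Real.sqrt 2 : ℂ)⁻¹ / θ) •
      (zOp θ f - zOp (-θ) f - zbarOp θ f + zbarOp (-θ) f) := by
  have : (θ : ℂ) ≠ 0 := mod_cast hθ
  simp only [zOp, zbarOp, LinearMap.smul_apply, LinearMap.add_apply, LinearMap.sub_apply]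
  push_cast
  match_scalars <;> ring_nf <;> simp [ofReal_sqrt_two_sq_inv, this]

theorem coordDeriv_one_eq {θ : ℝ} (hθ : θ ≠ 0) (f : 𝓢(Plane, ℂ)) :
    coordDeriv 1 f = (-I * (Real.sqrt 2 : ℂ)⁻¹ / θ) •
      (zOp θ f - zOp (-θ) f + zbarOp θ f - zbarOp (-θ) f) := by
  have : (θ : ℂ) ≠ 0 := mod_cast hθ
  simp only [zOp, zbarOp, LinearMap.smul_apply, LinearMap.add_apply, LinearMap.sub_apply]
  push_cast
  match_scalars <;> ring_nf <;> simp [ofReal_sqrt_two_sq_inv, this]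


/-! ### Completeness of the matrix basis -/

section Complete

variable {θ : ℝ} (hθ : 0 < θ)

/-- The span of the matrix basis is stable under multiplication by polynomials. -/
theorem coordMul_mem_span (i : Fin 2) {f : 𝓢(Plane, ℂ)}
    (hf : f ∈ Submodule.span ℂ (Set.range fun p : ℕ × ℕ => matrixBasis hθ p.1 p.2)) :
    coordMul i f ∈ Submodule.span ℂ (Set.range fun p : ℕ × ℕ => matrixBasis hθ p.1 p.2) := by
  have hmem : ∀ m n, matrixBasis hθ m n ∈
      Submodule.span ℂ (Set.range fun p : ℕ × ℕ => matrixBasis hθ p.1 p.2) :=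
    fun m n => Submodule.subset_span ⟨(m, n), rfl⟩
  induction hf using Submodule.span_induction with
  | mem f hf =>
    obtain ⟨⟨m, n⟩, rfl⟩ := hf
    have h1 := Submodule.smul_mem _ (lad θ m) (hmem (m - 1) n)
    have h2 := Submodule.smul_mem _ (lad θ (n + 1)) (hmem m (n + 1))
    have h3 := Submodule.smul_mem _ (lad θ (m + 1)) (hmem (m + 1) n)
    have h4 := Submodule.smul_mem _ (lad θ n) (hmem m (n - 1))
    fin_cases i
    · change coordMul 0 (matrixBasis hθ m n) ∈ _
      rw [coordMul_zero_eq θ, zOp_matrixBasis, zOp_neg_matrixBasis, zbarOp_matrixBasis,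
        zbarOp_neg_matrixBasis]
      exact Submodule.smul_mem _ _ (add_mem (add_mem (add_mem h1 h2) h3) h4)
    · change coordMul 1 (matrixBasis hθ m n) ∈ _
      rw [coordMul_one_eq θ, zOp_matrixBasis, zOp_neg_matrixBasis, zbarOp_matrixBasis,
        zbarOp_neg_matrixBasis]
      exact Submodule.smul_mem _ _ (sub_mem (sub_mem (add_mem h1 h2) h3) h4)
  | zero => rw [map_zero]; exact zero_mem _
  | add f g _ _ hf hg => rw [map_add]; exact add_mem hf hg
  | smul c f _ hf => rw [map_smul]; exact Submodule.smul_mem _ c hf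

/-- If the coefficients of `g` vanish, then `f₀₀ g` is orthogonal to all powers of linear forms. -/
theorem integral_inner_pow_mul_ground {g : 𝓢(Plane, ℂ)}
    (hg : ∀ m n, pair (matrixBasis hθ m n) g = 0) (t : Plane) (n : ℕ) :
    ∫ x, (inner ℝ x t : ℂ) ^ n * (ground hθ x * g x) = 0 := by
  let S := Submodule.span ℂ (Set.range fun p : ℕ × ℕ => matrixBasis hθ p.1 p.2)
  have hS : ∀ f ∈ S, pair f g = 0 := by
    intro f hf
    induction hf using Submodule.span_induction with
    | mem f hf => obtain ⟨⟨m, n⟩, rfl⟩ := hf; exact hg m n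
    | zero => simp [pair]
    | add f g _ _ hf hg => rw [pair_add_left, hf, hg, add_zero]
    | smul c f _ hf => rw [pair_smul_left, hf, mul_zero]
  have hex : ∃ f ∈ S, ∀ x, f x = (inner ℝ x t : ℂ) ^ n * ground hθ x := by
    induction n with
    | zero =>
      refine ⟨ground hθ, ?_, fun x => by simp⟩
      rw [← matrixBasis_zero_zero]
      exact Submodule.subset_span ⟨(0, 0), rfl⟩
    | succ n ih =>
      obtain ⟨f, hf, h⟩ := ih
      refine ⟨(t 0 : ℂ) • coordMul 0 f + (t 1 : ℂ) • coordMul 1 f,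
        add_mem (Submodule.smul_mem _ _ (coordMul_mem_span hθ 0 hf))
          (Submodule.smul_mem _ _ (coordMul_mem_span hθ 1 hf)), fun x => ?_⟩
      simp only [add_apply, smul_apply, coordMul_apply, h, PiLp.inner_apply, Fin.sum_univ_two,
        smul_eq_mul]
      simp
      ring
  obtain ⟨f, hf, h⟩ := hex
  rw [← hS f hf, pair]
  congr 1
  ext x
  rw [h]; ring

theorem integrable_exp_mul_ground_mul (g : 𝓢(Plane, ℂ)) (c : ℝ) (t : Plane) :
    Integrable fun x : Plane => Real.exp (c * ‖(inner ℝ x t : ℝ)‖) * ‖ground hθ x * g x‖ := by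
  have hcont : Continuous fun x : Plane => Real.exp (c * ‖(inner ℝ x t : ℝ)‖) *
      ‖ground hθ x * g x‖ := by
    have h1 := (ground hθ).continuous
    have h2 := g.continuous
    fun_prop
  let K : ℝ := 2 * Real.exp ((|c| * ‖t‖) ^ 2 * θ / 4)
  refine (g.integrable.norm.const_mul K).mono' hcont.aestronglyMeasurable
    (Filter.Eventually.of_forall fun x => ?_)
  have hnn : 0 ≤ Real.exp (c * ‖(inner ℝ x t : ℝ)‖) * ‖ground hθ x * g x‖ := by positivity
  rw [Real.norm_of_nonneg hnn, norm_mul, ← mul_assoc]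
  gcongr
  have hnn' : 0 ≤ 2 * Real.exp (-(1 / θ) * ‖x‖ ^ 2) := by positivity
  rw [ground_apply_real, norm_real, Real.norm_of_nonneg hnn', mul_left_comm,
    ← Real.exp_add]
  refine mul_le_mul_of_nonneg_left (Real.exp_le_exp.2 ?_) (by norm_num)
  have h1 : c * ‖(inner ℝ x t : ℝ)‖ ≤ |c| * (‖x‖ * ‖t‖) := by
    calc c * ‖(inner ℝ x t : ℝ)‖ ≤ |c| * ‖(inner ℝ x t : ℝ)‖ := by gcongr; exact le_abs_self c
      _ ≤ _ := by gcongr; exact norm_inner_le_norm x t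
  -- completing the square
  have h2 : 0 ≤ (1 / θ) * (‖x‖ - |c| * ‖t‖ * θ / 2) ^ 2 := by positivity
  have h3 : (1 / θ) * (‖x‖ - |c| * ‖t‖ * θ / 2) ^ 2 =
      (1 / θ) * ‖x‖ ^ 2 - |c| * (‖x‖ * ‖t‖) + (|c| * ‖t‖) ^ 2 * θ / 4 := by
    field_simp; ring
  linarith

/-- A Schwartz function whose coefficients in the matrix basis all vanish is zero: the Fourier
transform of its product with the ground state is given by an exponential series whose terms are
pairings with polynomials times the ground state. -/
theorem eq_zero_of_pair_matrixBasis {g : 𝓢(Plane, ℂ)}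
    (hg : ∀ m n, pair (matrixBasis hθ m n) g = 0) : g = 0 := by
  let h : 𝓢(Plane, ℂ) := SchwartzMap.pairing (ContinuousLinearMap.mul ℂ ℂ) (ground hθ) g
  have hh : ∀ x, h x = ground hθ x * g x := fun x => rfl
  have hF : 𝓕 h = 0 := by
    ext ξ
    rw [SchwartzMap.fourier_coe, Real.fourier_eq, zero_apply]
    have hs := hasSum_integral_of_dominated_convergence (μ := (volume : Measure Plane))
      (F := fun (n : ℕ) x => ((n.factorial : ℂ)⁻¹ * (-(2 * Real.pi * I)) ^ n) *
        ((inner ℝ x ξ : ℂ) ^ n * (ground hθ x * g x)))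
      (f := fun x => cexp (-(2 * Real.pi * I) * inner ℝ x ξ) * (ground hθ x * g x))
      (bound := fun (n : ℕ) x => ((2 * Real.pi * ‖(inner ℝ x ξ : ℝ)‖) ^ n / n.factorial) *
        ‖ground hθ x * g x‖)
      (fun n => by
        have h1 := (ground hθ).continuous
        have h2 := g.continuous
        refine Continuous.aestronglyMeasurable ?_
        fun_prop)
      (fun n => Filter.Eventually.of_forall fun x => by
        simp only [norm_mul, norm_inv, norm_pow, norm_neg, Complex.norm_real, Complex.norm_I,
          RCLike.norm_natCast, Complex.norm_ofNat, mul_one, mul_pow, Real.norm_of_nonneg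
          Real.pi_pos.le]
        apply le_of_eq
        ring)
      (Filter.Eventually.of_forall fun x => (Real.summable_pow_div_factorial _).mul_right _)
      (by
        have := integrable_exp_mul_ground_mul hθ g (2 * Real.pi) ξ
        refine this.congr (Filter.Eventually.of_forall fun x => ?_)
        simp only
        rw [tsum_mul_right, Real.exp_eq_exp_ℝ, NormedSpace.exp_eq_tsum_div])
      (Filter.Eventually.of_forall fun x => by
        have h1 := (NormedSpace.expSeries_div_hasSum_exp (𝔸 := ℂ)
          (-(2 * Real.pi * I) * inner ℝ x ξ)).mul_right (ground hθ x * g x)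
        rw [← Complex.exp_eq_exp_ℂ] at h1
        refine (congrArg (fun u => HasSum u _) (funext fun n => ?_)).mpr h1
        rw [mul_pow]; ring)
    simp only [integral_const_mul, integral_inner_pow_mul_ground hθ hg, mul_zero] at hs
    rw [← hs.unique hasSum_zero]
    refine integral_congr_ae (Filter.Eventually.of_forall fun x => ?_)
    simp only [hh]
    rw [Circle.smul_def, Real.fourierChar_apply, smul_eq_mul]
    congr 2
    push_cast; ring
  have h0 : h = 0 := by
    rw [← FourierTransform.fourierInv_fourier_eq (F := 𝓢(Plane, ℂ)) h, hF]
    exact map_zero (FourierTransform.fourierInvCLM ℂ 𝓢(Plane, ℂ))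
  ext x
  have h1 := hh x
  rw [h0, zero_apply, ground_apply] at h1
  simpa using h1.symm

/-- The ground state is idempotent: `f₀₀ ⋆ f₀₀` is annihilated by `z ⋆ ·` and by `· ⋆ z̄`, hence, by
completeness, a multiple of `f₀₀`. -/
theorem moyalProd_ground_ground : moyalProd θ (ground hθ) (ground hθ) = ground hθ := by
  set h := moyalProd θ (ground hθ) (ground hθ) with hh
  have hz : zOp θ h = 0 := by
    rw [hh, zOp_moyalProd_left hθ.ne', zOp_ground]
    simpa using moyalProd_smul_left θ 0 0 (ground hθ)
  have hzb : zbarOp (-θ) h = 0 := by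
    rw [hh, zbarOp_moyalProd_right hθ.ne', zbarOp_neg_ground]
    simpa using moyalProd_smul_right θ 0 (ground hθ) 0
  have hπ : (2 * Real.pi * θ : ℂ) ≠ 0 := by
    have := Real.pi_ne_zero
    have := hθ.ne'
    norm_cast
    positivity
  let c : ℂ := pair (ground hθ) h / (2 * Real.pi * θ)
  have hc : h - c • ground hθ = 0 := by
    refine eq_zero_of_pair_matrixBasis hθ fun m n => ?_
    rw [pair_sub_right, pair_smul_right]
    have hb := fun m n => pair_matrixBasis hθ m n 0 0
    simp only [matrixBasis_zero_zero] at hb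
    rw [hb]
    rcases m with _ | m
    · rcases n with _ | n
      · rw [matrixBasis_zero_zero]
        simp [c]
        field_simp
        ring
      · have : pair (matrixBasis hθ 0 (n + 1)) h = 0 := by
          apply mul_left_cancel₀ (lad_succ_ne_zero hθ n)
          rw [pair_matrixBasis_succ_right, hz, pair_zero_right, mul_zero]
        simp [this]
    · have : pair (matrixBasis hθ (m + 1) n) h = 0 := by
        apply mul_left_cancel₀ (lad_succ_ne_zero hθ m)
        rw [pair_matrixBasis_succ_left, hzb, pair_zero_right, mul_zero]
      simp [this]
  rw [sub_eq_zero] at hc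
  -- the constant is found by integrating
  have h1 := integral_moyalProd hθ.ne' (ground hθ) (ground hθ)
  rw [← hh, hc, pair_ground_ground] at h1
  simp only [smul_apply, smul_eq_mul] at h1
  rw [integral_const_mul, integral_ground] at h1
  have h2 : c = 1 := mul_right_cancel₀ hπ (by rw [h1, one_mul])
  rw [hc, h2, one_smul]

/-- The matrix basis multiplies like matrix units: `f_mn ⋆ f_kl = δ_nk f_ml`. -/
theorem moyalProd_matrixBasis (m n k l : ℕ) :
    moyalProd θ (matrixBasis hθ m n) (matrixBasis hθ k l) =
      if n = k then matrixBasis hθ m l else 0 :=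
  moyalProd_matrixBasis_of_ground hθ (moyalProd_ground_ground hθ) m n k l

end Complete


/-! ### Polynomial bounds for the matrix basis -/

/-- The weight `(1 + m)(1 + n)`. -/
def wt (m n : ℕ) : ℝ := (1 + m) * (1 + n)

theorem one_le_wt (m n : ℕ) : 1 ≤ wt m n :=
  one_le_mul_of_one_le_of_one_le (by simp) (by simp)

theorem wt_pos (m n : ℕ) : 0 < wt m n := one_pos.trans_le (one_le_wt m n)

/-- A function on the Schwartz space grows at most polynomially along the matrix basis. -/
def PolyGrowth {θ : ℝ} (hθ : 0 < θ) (p : 𝓢(Plane, ℂ) → ℝ) : Prop :=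
  ∃ (C : ℝ) (r : ℕ), 0 ≤ C ∧ ∀ m n, p (matrixBasis hθ m n) ≤ C * wt m n ^ r

section Growth

variable {θ : ℝ} {hθ : 0 < θ}

theorem PolyGrowth.mono {p q : 𝓢(Plane, ℂ) → ℝ} (hq : PolyGrowth hθ q) (h : ∀ f, p f ≤ q f) :
    PolyGrowth hθ p := by
  obtain ⟨C, r, hC, hb⟩ := hq
  exact ⟨C, r, hC, fun m n => (h _).trans (hb m n)⟩

theorem PolyGrowth.add {p q : 𝓢(Plane, ℂ) → ℝ} (hp : PolyGrowth hθ p) (hq : PolyGrowth hθ q) :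
    PolyGrowth hθ (fun f => p f + q f) := by
  obtain ⟨C, r, hC, hb⟩ := hp
  obtain ⟨D, s, hD, hd⟩ := hq
  refine ⟨C + D, r + s, by positivity, fun m n => ?_⟩
  have hw := one_le_wt m n
  calc _ ≤ C * wt m n ^ r + D * wt m n ^ s := add_le_add (hb m n) (hd m n)
    _ ≤ C * wt m n ^ (r + s) + D * wt m n ^ (r + s) := by
      exact add_le_add (mul_le_mul_of_nonneg_left (pow_le_pow_right₀ hw (by omega)) hC)
        (mul_le_mul_of_nonneg_left (pow_le_pow_right₀ hw (by omega)) hD)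
    _ = _ := by ring

theorem PolyGrowth.const_mul {p : 𝓢(Plane, ℂ) → ℝ} (hp : PolyGrowth hθ p) {c : ℝ} (hc : 0 ≤ c) :
    PolyGrowth hθ (fun f => c * p f) := by
  obtain ⟨C, r, hC, hb⟩ := hp
  refine ⟨c * C, r, by positivity, fun m n => ?_⟩
  calc _ ≤ c * (C * wt m n ^ r) := mul_le_mul_of_nonneg_left (hb m n) hc
    _ = _ := by ring

theorem norm_lad_le {θ : ℝ} (hθ : 0 < θ) (k : ℕ) : ‖lad θ k‖ ≤ (1 + θ) * (1 + k) := by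
  rw [lad, norm_real, Real.norm_of_nonneg (Real.sqrt_nonneg _)]
  have h1 : Real.sqrt (θ * k) ≤ 1 + θ * k := by
    rw [Real.sqrt_le_left (by positivity)]
    nlinarith [show 0 ≤ θ * (k : ℝ) by positivity]
  have : 0 ≤ (k : ℝ) := by positivity
  nlinarith

/-- An operator that moves each basis element to a neighbour, with a coefficient of linear growth,
preserves polynomial growth. -/
theorem PolyGrowth.comp_of_ladder {p : Seminorm ℂ 𝓢(Plane, ℂ)} (hp : PolyGrowth hθ p)
    {T : Module.End ℂ 𝓢(Plane, ℂ)} {k m' n' : ℕ → ℕ → ℕ}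
    (hT : ∀ m n, T (matrixBasis hθ m n) = lad θ (k m n) • matrixBasis hθ (m' m n) (n' m n))
    (hk : ∀ m n, (1 + k m n : ℝ) ≤ 2 * wt m n) (hw : ∀ m n, wt (m' m n) (n' m n) ≤ 2 * wt m n) :
    PolyGrowth hθ (fun f => p (T f)) := by
  obtain ⟨C, r, hC, hb⟩ := hp
  refine ⟨(1 + θ) * 2 * (C * 2 ^ r), r + 1, by positivity, fun m n => ?_⟩
  simp only [hT, map_smul_eq_mul]
  have := wt_pos (m' m n) (n' m n)
  have := wt_pos m n
  calc _ ≤ ((1 + θ) * (1 + k m n)) * (C * wt (m' m n) (n' m n) ^ r) :=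
        mul_le_mul (norm_lad_le hθ _) (hb _ _) (apply_nonneg p _) (by positivity)
    _ ≤ ((1 + θ) * (2 * wt m n)) * (C * (2 * wt m n) ^ r) := by
        gcongr
        · exact hk m n
        · exact hw m n
    _ = _ := by rw [mul_pow]; ring

theorem PolyGrowth.comp_zOp {p : Seminorm ℂ 𝓢(Plane, ℂ)} (hp : PolyGrowth hθ p) :
    PolyGrowth hθ (fun f => p (zOp θ f)) :=
  hp.comp_of_ladder (zOp_matrixBasis hθ)
    (fun m n => by rw [wt]; nlinarith [show (0 : ℝ) ≤ m * n by positivity,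
      show (0 : ℝ) ≤ m by positivity, show (0 : ℝ) ≤ n by positivity])
    (fun m n => by
      have h : ((m - 1 : ℕ) : ℝ) ≤ m := by exact_mod_cast Nat.sub_le m 1
      rw [wt, wt]
      nlinarith [show (0 : ℝ) ≤ m * n by positivity, show (0 : ℝ) ≤ m by positivity,
        show (0 : ℝ) ≤ n by positivity])

theorem PolyGrowth.comp_zbarOp_neg {p : Seminorm ℂ 𝓢(Plane, ℂ)} (hp : PolyGrowth hθ p) :
    PolyGrowth hθ (fun f => p (zbarOp (-θ) f)) :=
  hp.comp_of_ladder (zbarOp_neg_matrixBasis hθ)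
    (fun m n => by rw [wt]; nlinarith [show (0 : ℝ) ≤ m * n by positivity,
      show (0 : ℝ) ≤ m by positivity, show (0 : ℝ) ≤ n by positivity])
    (fun m n => by
      have h : ((n - 1 : ℕ) : ℝ) ≤ n := by exact_mod_cast Nat.sub_le n 1
      rw [wt, wt]
      nlinarith [show (0 : ℝ) ≤ m * n by positivity, show (0 : ℝ) ≤ m by positivity,
        show (0 : ℝ) ≤ n by positivity])

theorem PolyGrowth.comp_zbarOp {p : Seminorm ℂ 𝓢(Plane, ℂ)} (hp : PolyGrowth hθ p) :
    PolyGrowth hθ (fun f => p (zbarOp θ f)) :=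
  hp.comp_of_ladder (zbarOp_matrixBasis hθ)
    (fun m n => by rw [wt]; push_cast; nlinarith [show (0 : ℝ) ≤ m * n by positivity,
      show (0 : ℝ) ≤ m by positivity, show (0 : ℝ) ≤ n by positivity])
    (fun m n => by
      rw [wt, wt]; push_cast
      nlinarith [show (0 : ℝ) ≤ m * n by positivity, show (0 : ℝ) ≤ m by positivity,
        show (0 : ℝ) ≤ n by positivity])

theorem PolyGrowth.comp_zOp_neg {p : Seminorm ℂ 𝓢(Plane, ℂ)} (hp : PolyGrowth hθ p) :
    PolyGrowth hθ (fun f => p (zOp (-θ) f)) :=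
  hp.comp_of_ladder (zOp_neg_matrixBasis hθ)
    (fun m n => by rw [wt]; push_cast; nlinarith [show (0 : ℝ) ≤ m * n by positivity,
      show (0 : ℝ) ≤ m by positivity, show (0 : ℝ) ≤ n by positivity])
    (fun m n => by
      rw [wt, wt]; push_cast
      nlinarith [show (0 : ℝ) ≤ m * n by positivity, show (0 : ℝ) ≤ m by positivity,
        show (0 : ℝ) ≤ n by positivity])

theorem PolyGrowth.comp_of_smul_sum {p : Seminorm ℂ 𝓢(Plane, ℂ)} (hp : PolyGrowth hθ p)
    {T : Module.End ℂ 𝓢(Plane, ℂ)} {c c₁ c₂ c₃ c₄ : ℂ}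
    (hT : ∀ f, T f = c • (c₁ • zOp θ f + c₂ • zOp (-θ) f + c₃ • zbarOp θ f +
      c₄ • zbarOp (-θ) f)) :
    PolyGrowth hθ (fun f => p (T f)) := by
  refine (((((hp.comp_zOp.const_mul (norm_nonneg c₁)).add
    (hp.comp_zOp_neg.const_mul (norm_nonneg c₂))).add
    (hp.comp_zbarOp.const_mul (norm_nonneg c₃))).add
    (hp.comp_zbarOp_neg.const_mul (norm_nonneg c₄))).const_mul (norm_nonneg c)).mono fun f => ?_
  rw [hT, map_smul_eq_mul]
  gcongr
  simp only [← map_smul_eq_mul p]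
  refine (map_add_le_add p _ _).trans ?_
  gcongr
  refine (map_add_le_add p _ _).trans ?_
  gcongr
  exact map_add_le_add p _ _

theorem PolyGrowth.comp_coordMul {p : Seminorm ℂ 𝓢(Plane, ℂ)} (hp : PolyGrowth hθ p)
    (i : Fin 2) : PolyGrowth hθ (p.comp (coordMul i)) := by
  fin_cases i
  · exact hp.comp_of_smul_sum (T := coordMul 0)
      (c := (Real.sqrt 2 : ℂ)⁻¹ / 2) (c₁ := 1) (c₂ := 1) (c₃ := 1) (c₄ := 1) fun f =>
      (coordMul_zero_eq θ f).trans (by module)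
  · exact hp.comp_of_smul_sum (T := coordMul 1)
      (c := -I * (Real.sqrt 2 : ℂ)⁻¹ / 2) (c₁ := 1) (c₂ := 1) (c₃ := -1) (c₄ := -1) fun f =>
      (coordMul_one_eq θ f).trans (by module)

theorem PolyGrowth.comp_coordDeriv {p : Seminorm ℂ 𝓢(Plane, ℂ)} (hp : PolyGrowth hθ p)
    (i : Fin 2) : PolyGrowth hθ (p.comp (coordDeriv i)) := by
  fin_cases i
  · exact hp.comp_of_smul_sum (T := coordDeriv 0)
      (c := (Real.sqrt 2 : ℂ)⁻¹ / θ) (c₁ := 1) (c₂ := -1) (c₃ := -1) (c₄ := 1)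
      fun f => (coordDeriv_zero_eq hθ.ne' f).trans (by module)
  · exact hp.comp_of_smul_sum (T := coordDeriv 1)
      (c := -I * (Real.sqrt 2 : ℂ)⁻¹ / θ) (c₁ := 1) (c₂ := -1) (c₃ := 1) (c₄ := -1)
      fun f => (coordDeriv_one_eq hθ.ne' f).trans (by module)

/-- The `L^p` norm as a seminorm on the Schwartz space. -/
noncomputable def lpSeminorm (p : ENNReal) [Fact (1 ≤ p)] : Seminorm ℂ 𝓢(Plane, ℂ) :=
  (normSeminorm ℂ (Lp ℂ p (volume : Measure Plane))).comp
    (SchwartzMap.toLpCLM ℂ ℂ p (volume : Measure Plane)).toLinearMap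

theorem lpSeminorm_one (f : 𝓢(Plane, ℂ)) : lpSeminorm 1 f = ∫ x, ‖f x‖ :=
  SchwartzMap.norm_toLp_one

theorem lpSeminorm_two_sq (f : 𝓢(Plane, ℂ)) : ((lpSeminorm 2 f) ^ 2 : ℝ) = ∫ x, ‖f x‖ ^ 2 := by
  have h := SchwartzMap.inner_toL2_toL2_eq f f (volume : Measure Plane)
  rw [inner_self_eq_norm_sq_to_K] at h
  have h2 : ∀ x, inner ℂ (f x) (f x) = ((‖f x‖ ^ 2 : ℝ) : ℂ) := fun x => by
    rw [inner_self_eq_norm_sq_to_K]; push_cast; rfl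
  simp only [h2, integral_complex_ofReal] at h
  have h' : ‖f.toLp 2 (volume : Measure Plane)‖ ^ 2 = ∫ x, ‖f x‖ ^ 2 :=
    Complex.ofReal_injective ((ofReal_pow _ 2).trans h)
  exact h'

/-- The basis has constant `L²` norm. -/
theorem polyGrowth_lpSeminorm_two (hθ : 0 < θ) : PolyGrowth hθ (lpSeminorm 2) := by
  refine ⟨Real.sqrt (2 * Real.pi * θ), 0, by positivity, fun m n => ?_⟩
  rw [pow_zero, mul_one]
  apply Real.le_sqrt_of_sq_le
  rw [lpSeminorm_two_sq]
  have h := pair_matrixBasis hθ n m m n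
  rw [if_pos ⟨rfl, rfl⟩, ← conjS_matrixBasis] at h
  have h2 : ∀ x, conjS (matrixBasis hθ m n) x * matrixBasis hθ m n x =
      ((‖matrixBasis hθ m n x‖ ^ 2 : ℝ) : ℂ) := fun x => by
    rw [conjS_apply, conj_mul', ofReal_pow]
  simp only [pair, h2, integral_complex_ofReal] at h
  exact le_of_eq (mod_cast h)

/-- The `L¹` norm is controlled by a weighted `L²` norm. -/
theorem exists_lpSeminorm_one_le : ∃ K : ℝ, 0 ≤ K ∧ ∀ h : 𝓢(Plane, ℂ), lpSeminorm 1 h ≤ K +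
    (lpSeminorm 2 (h + coordMul 0 (coordMul 0 h) + coordMul 1 (coordMul 1 h))) ^ 2 := by
  have hi : Integrable (fun x : Plane => (1 + ‖x‖ ^ 2) ^ (-(4 : ℝ) / 2)) :=
    integrable_rpow_neg_one_add_norm_sq (by simp; norm_num)
  refine ⟨∫ x : Plane, (1 + ‖x‖ ^ 2) ^ (-(4 : ℝ) / 2),
    integral_nonneg fun x => by positivity, fun h => ?_⟩
  rw [lpSeminorm_one, lpSeminorm_two_sq]
  set T := h + coordMul 0 (coordMul 0 h) + coordMul 1 (coordMul 1 h) with hT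
  have hTx : ∀ x, ‖T x‖ = (1 + ‖x‖ ^ 2) * ‖h x‖ := by
    intro x
    have : T x = ((1 + ‖x‖ ^ 2 : ℝ) : ℂ) * h x := by
      rw [hT]
      simp only [add_apply, coordMul_apply, EuclideanSpace.real_norm_sq_eq, Fin.sum_univ_two]
      push_cast; ring
    rw [this, norm_mul, norm_real, Real.norm_of_nonneg (by positivity)]
  have hi2 : Integrable (fun x => ‖T x‖ ^ 2) := (T.memLp 2 volume).integrable_norm_pow (by norm_num)
  rw [← integral_add hi hi2]
  refine integral_mono h.integrable.norm (hi.add hi2) fun x => ?_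
  have h4 : (1 + ‖x‖ ^ 2) ^ (-(4 : ℝ) / 2) = ((1 + ‖x‖ ^ 2)⁻¹) ^ 2 := by
    rw [show (-(4 : ℝ) / 2) = -((2 : ℕ) : ℝ) by norm_num, Real.rpow_neg (by positivity),
      Real.rpow_natCast, inv_pow]
  change ‖h x‖ ≤ (1 + ‖x‖ ^ 2) ^ (-(4 : ℝ) / 2) + ‖T x‖ ^ 2
  rw [h4, hTx]
  have h5 : ‖h x‖ = (1 + ‖x‖ ^ 2)⁻¹ * ((1 + ‖x‖ ^ 2) * ‖h x‖) := by
    field_simp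
  have h6 : 0 ≤ (1 + ‖x‖ ^ 2)⁻¹ := by positivity
  have h7 : 0 ≤ (1 + ‖x‖ ^ 2) * ‖h x‖ := by positivity
  conv_lhs => rw [h5]
  nlinarith [sq_nonneg ((1 + ‖x‖ ^ 2)⁻¹ - (1 + ‖x‖ ^ 2) * ‖h x‖)]

theorem polyGrowth_lpSeminorm_one (hθ : 0 < θ) : PolyGrowth hθ (lpSeminorm 1) := by
  obtain ⟨K, hK, h⟩ := exists_lpSeminorm_one_le
  have hp := polyGrowth_lpSeminorm_two hθ
  obtain ⟨C, r, hC, hb⟩ := ((hp.add ((hp.comp_coordMul 0).comp_coordMul 0)).add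
    ((hp.comp_coordMul 1).comp_coordMul 1))
  refine ⟨K + C ^ 2, r * 2, by positivity, fun m n => (h _).trans ?_⟩
  have h1 := (map_add_le_add (lpSeminorm 2) (matrixBasis hθ m n +
    coordMul 0 (coordMul 0 (matrixBasis hθ m n))) (coordMul 1 (coordMul 1 (matrixBasis hθ m n))))
  have h2 := map_add_le_add (lpSeminorm 2) (matrixBasis hθ m n)
    (coordMul 0 (coordMul 0 (matrixBasis hθ m n)))
  have h3 := hb m n
  simp only [Seminorm.comp_apply] at h3
  have h4 := (h1.trans (add_le_add_left h2 _)).trans h3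
  calc _ ≤ K + (C * wt m n ^ r) ^ 2 := by gcongr
    _ ≤ K * wt m n ^ (r * 2) + (C * wt m n ^ r) ^ 2 := by
      gcongr
      exact le_mul_of_one_le_right hK (one_le_pow₀ (one_le_wt m n))
    _ = _ := by ring

theorem norm_moyalProd_le (θ : ℝ) (f g : 𝓢(Plane, ℂ)) (x : Plane) :
    ‖moyalProd θ f g x‖ ≤ 1 / (Real.pi * θ) ^ 2 * (lpSeminorm 1 f * lpSeminorm 1 g) := by
  rw [moyalProd_apply, moyalIntegral, norm_mul]
  have h1 : ‖(1 / ((Real.pi * θ) ^ 2 : ℝ) : ℂ)‖ = 1 / (Real.pi * θ) ^ 2 := by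
    rw [norm_div, norm_one, norm_real, Real.norm_of_nonneg (by positivity)]
  rw [h1]
  gcongr
  refine (norm_integral_le_integral_norm _).trans (le_of_eq ?_)
  simp only [norm_mul, norm_moyalPhase, mul_one]
  refine (integral_prod_mul (μ := (volume : Measure Plane)) (ν := (volume : Measure Plane))
    (fun y => ‖f (x + y)‖) (fun z => ‖g (x + z)‖)).trans ?_
  rw [integral_add_left_eq_self (fun y => ‖f y‖) x, integral_add_left_eq_self (fun y => ‖g y‖) x,
    lpSeminorm_one, lpSeminorm_one]

/-- The supremum norms of the basis grow polynomially, because `f_mn = f_m0 ⋆ f_0n` and the Moyal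
product is bounded by the product of the `L¹` norms. -/
theorem polyGrowth_seminorm_zero_zero (hθ : 0 < θ) :
    PolyGrowth hθ (SchwartzMap.seminorm ℂ 0 0) := by
  obtain ⟨C, r, hC, hb⟩ := polyGrowth_lpSeminorm_one hθ
  refine ⟨1 / (Real.pi * θ) ^ 2 * C ^ 2, r, by positivity, fun m n => ?_⟩
  have hw := wt_pos m n
  refine SchwartzMap.seminorm_le_bound ℂ 0 0 _ (by positivity) fun x => ?_
  rw [pow_zero, one_mul, norm_iteratedFDeriv_zero]
  have h := moyalProd_matrixBasis hθ m 0 0 n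
  rw [if_pos rfl] at h
  rw [← h]
  refine (norm_moyalProd_le _ _ _ _).trans ?_
  rw [mul_assoc]
  refine mul_le_mul_of_nonneg_left ?_ (by positivity)
  calc _ ≤ (C * wt m 0 ^ r) * (C * wt 0 n ^ r) :=
        mul_le_mul (hb m 0) (hb 0 n) (apply_nonneg _ _)
          (by have := wt_pos m 0; positivity)
    _ = C ^ 2 * (wt m 0 * wt 0 n) ^ r := by rw [mul_pow]; ring
    _ = _ := by simp [wt]

theorem seminorm_succ_zero_le (k : ℕ) (f : 𝓢(Plane, ℂ)) :
    SchwartzMap.seminorm ℂ (k + 1) 0 f ≤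
      SchwartzMap.seminorm ℂ k 0 (coordMul 0 f) + SchwartzMap.seminorm ℂ k 0 (coordMul 1 f) := by
  refine SchwartzMap.seminorm_le_bound ℂ _ _ _ (by positivity) fun x => ?_
  have h0 := SchwartzMap.norm_pow_mul_le_seminorm ℂ (coordMul 0 f) k x
  have h1 := SchwartzMap.norm_pow_mul_le_seminorm ℂ (coordMul 1 f) k x
  rw [coordMul_apply, norm_mul, norm_real, Real.norm_eq_abs] at h0 h1
  rw [norm_iteratedFDeriv_zero]
  have h2 : ‖x‖ ≤ |x 0| + |x 1| := by
    have := EuclideanSpace.real_norm_sq_eq x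
    rw [Fin.sum_univ_two] at this
    refine abs_le_of_sq_le_sq' ?_ (by positivity) |>.2
    rw [this, add_sq, sq_abs, sq_abs]
    nlinarith [abs_nonneg (x 0), abs_nonneg (x 1), mul_nonneg (abs_nonneg (x 0)) (abs_nonneg (x 1))]
  calc ‖x‖ ^ (k + 1) * ‖f x‖ = ‖x‖ ^ k * ‖f x‖ * ‖x‖ := by ring
    _ ≤ ‖x‖ ^ k * ‖f x‖ * (|x 0| + |x 1|) := by gcongr
    _ = ‖x‖ ^ k * (|x 0| * ‖f x‖) + ‖x‖ ^ k * (|x 1| * ‖f x‖) := by ring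
    _ ≤ _ := add_le_add h0 h1

theorem exists_seminorm_succ_le : ∃ C : ℝ, 0 ≤ C ∧ ∀ (k n : ℕ) (f : 𝓢(Plane, ℂ)),
    SchwartzMap.seminorm ℂ k (n + 1) f ≤
      C * (SchwartzMap.seminorm ℂ k n (coordDeriv 0 f) +
        SchwartzMap.seminorm ℂ k n (coordDeriv 1 f)) := by
  let L : Fin 2 → (ℂ →L[ℝ] (Plane →L[ℝ] ℂ)) := fun i =>
    ContinuousLinearMap.smulRightL ℝ Plane ℂ (EuclideanSpace.proj i)
  refine ⟨‖L 0‖ + ‖L 1‖, by positivity, fun k n f => ?_⟩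
  refine SchwartzMap.seminorm_le_bound ℂ _ _ _ (by positivity) fun x => ?_
  have hf : fderiv ℝ f = fun y => (L 0 ∘ coordDeriv 0 f) y + (L 1 ∘ coordDeriv 1 f) y := by
    funext y
    ext v
    have hv : v = v 0 • dir 0 + v 1 • dir 1 := by
      ext i; fin_cases i <;> simp [dir]
    conv_lhs => rw [hv, map_add, map_smul, map_smul]
    simp [L, coordDeriv_apply]
  have hs : ∀ i, ContDiff ℝ n (L i ∘ coordDeriv i f) := fun i =>
    (L i).contDiff.comp ((coordDeriv i f).smooth n)
  have hi : ∀ i, ‖iteratedFDeriv ℝ n (L i ∘ coordDeriv i f) x‖ ≤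
      ‖L i‖ * ‖iteratedFDeriv ℝ n (coordDeriv i f) x‖ := fun i =>
    (L i).norm_iteratedFDeriv_comp_left ((coordDeriv i f).smooth n).contDiffAt le_rfl
  rw [← norm_iteratedFDeriv_fderiv, hf, fun_iteratedFDeriv_add_apply (hs 0).contDiffAt
    (hs 1).contDiffAt]
  have h0 := SchwartzMap.le_seminorm ℂ k n (coordDeriv 0 f) x
  have h1 := SchwartzMap.le_seminorm ℂ k n (coordDeriv 1 f) x
  have a0 := apply_nonneg (SchwartzMap.seminorm ℂ k n) (coordDeriv 0 f)
  have a1 := apply_nonneg (SchwartzMap.seminorm ℂ k n) (coordDeriv 1 f)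
  calc _ ≤ ‖x‖ ^ k * (‖L 0‖ * ‖iteratedFDeriv ℝ n (coordDeriv 0 f) x‖ +
        ‖L 1‖ * ‖iteratedFDeriv ℝ n (coordDeriv 1 f) x‖) := by
        gcongr
        exact (norm_add_le _ _).trans (add_le_add (hi 0) (hi 1))
    _ = ‖L 0‖ * (‖x‖ ^ k * ‖iteratedFDeriv ℝ n (coordDeriv 0 f) x‖) +
        ‖L 1‖ * (‖x‖ ^ k * ‖iteratedFDeriv ℝ n (coordDeriv 1 f) x‖) := by ring
    _ ≤ ‖L 0‖ * SchwartzMap.seminorm ℂ k n (coordDeriv 0 f) +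
        ‖L 1‖ * SchwartzMap.seminorm ℂ k n (coordDeriv 1 f) := by gcongr
    _ ≤ _ := by nlinarith [norm_nonneg (L 0), norm_nonneg (L 1)]

/-- Every Schwartz seminorm grows at most polynomially along the matrix basis. -/
theorem polyGrowth_seminorm (hθ : 0 < θ) (k n : ℕ) :
    PolyGrowth hθ (SchwartzMap.seminorm ℂ k n) := by
  induction n with
  | zero =>
    induction k with
    | zero => exact polyGrowth_seminorm_zero_zero hθ
    | succ k ih =>
      exact ((ih.comp_coordMul 0).add (ih.comp_coordMul 1)).mono (seminorm_succ_zero_le k)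
  | succ n ih =>
    obtain ⟨C, hC, h⟩ := exists_seminorm_succ_le
    exact (((ih.comp_coordDeriv 0).add (ih.comp_coordDeriv 1)).const_mul hC).mono (h k n)

end Growth


/-! ### Expansion of Schwartz functions and tempered distributions -/

/-- Countable subadditivity of the Schwartz seminorms along a pointwise convergent series. -/
theorem seminorm_le_tsum_of_hasSum {ι : Type*} {u : ι → 𝓢(Plane, ℂ)}
    (hu : ∀ k n, Summable fun i => SchwartzMap.seminorm ℂ k n (u i)) (s : 𝓢(Plane, ℂ))
    (hs : ∀ x, HasSum (fun i => u i x) (s x)) (k n : ℕ) :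
    SchwartzMap.seminorm ℂ k n s ≤ ∑' i, SchwartzMap.seminorm ℂ k n (u i) := by
  refine SchwartzMap.seminorm_le_bound ℂ _ _ _ (tsum_nonneg fun i => apply_nonneg _ _) fun x => ?_
  have hsx : (s : Plane → ℂ) = fun x => ∑' i, u i x := funext fun x => (hs x).tsum_eq.symm
  have h1 : iteratedFDeriv ℝ n s x = ∑' i, iteratedFDeriv ℝ n (u i) x := by
    rw [hsx]
    exact iteratedFDeriv_tsum_apply (N := ⊤) (fun i => (u i).smooth ⊤)
      (v := fun k i => SchwartzMap.seminorm ℂ 0 k (u i)) (fun k _ => hu 0 k)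
      (fun k i x _ => (u i).norm_iteratedFDeriv_le_seminorm ℂ k x) le_top x
  have h2 : Summable fun i => iteratedFDeriv ℝ n (u i) x :=
    Summable.of_norm_bounded (hu 0 n) fun i => (u i).norm_iteratedFDeriv_le_seminorm ℂ n x
  have h3 : HasSum (fun i => ‖x‖ ^ k • iteratedFDeriv ℝ n (u i) x)
      (‖x‖ ^ k • iteratedFDeriv ℝ n s x) := by
    rw [h1]; exact h2.hasSum.const_smul _
  have h4 := h3.norm_le_of_bounded (hu k n).hasSum fun i => by
    rw [norm_smul, norm_pow, norm_norm]
    exact (u i).le_seminorm ℂ k n x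
  rwa [norm_smul, norm_pow, norm_norm] at h4

/-- A series of Schwartz functions that converges absolutely in every Schwartz seminorm
converges in the Schwartz space. -/
theorem exists_hasSum_of_summable_seminorm {ι : Type*} {u : ι → 𝓢(Plane, ℂ)}
    (hu : ∀ k n, Summable fun i => SchwartzMap.seminorm ℂ k n (u i)) :
    ∃ s : 𝓢(Plane, ℂ), HasSum u s := by
  have hsum : ∀ x, Summable fun i => u i x := fun x =>
    Summable.of_norm_bounded (hu 0 0) fun i => (u i).norm_le_seminorm ℂ x
  let s : 𝓢(Plane, ℂ) :=
    { toFun := fun x => ∑' i, u i x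
      smooth' := contDiff_tsum (N := ⊤) (fun i => (u i).smooth ⊤)
        (v := fun k i => SchwartzMap.seminorm ℂ 0 k (u i)) (fun k _ => hu 0 k)
        (fun k i x _ => (u i).norm_iteratedFDeriv_le_seminorm ℂ k x)
      decay' := fun k n => ⟨∑' i, SchwartzMap.seminorm ℂ k n (u i), fun x => by
        have h1 := iteratedFDeriv_tsum_apply (𝕜 := ℝ) (N := ⊤) (fun i => (u i).smooth ⊤)
          (v := fun k i => SchwartzMap.seminorm ℂ 0 k (u i)) (fun k _ => hu 0 k)
          (fun k i x _ => (u i).norm_iteratedFDeriv_le_seminorm ℂ k x) (k := n) le_top x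
        have h2 : Summable fun i => iteratedFDeriv ℝ n (u i) x :=
          Summable.of_norm_bounded (hu 0 n) fun i => (u i).norm_iteratedFDeriv_le_seminorm ℂ n x
        have h3 := h2.hasSum.const_smul (‖x‖ ^ k)
        have h4 := h3.norm_le_of_bounded (hu k n).hasSum fun i => by
          rw [norm_smul, norm_pow, norm_norm]
          exact (u i).le_seminorm ℂ k n x
        rwa [norm_smul, norm_pow, norm_norm, ← h1] at h4⟩ }
  have hs : ∀ x, s x = ∑' i, u i x := fun x => rfl
  refine ⟨s, ?_⟩
  rw [HasSum, (schwartz_withSeminorms ℂ Plane ℂ).tendsto_nhds]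
  rintro ⟨k, n⟩ ε hε
  have htail := tendsto_tsum_compl_atTop_zero fun i => SchwartzMap.seminorm ℂ k n (u i)
  filter_upwards [htail.eventually (gt_mem_nhds hε)] with F hF
  rw [← map_sub_rev]
  refine lt_of_le_of_lt ?_ hF
  refine seminorm_le_tsum_of_hasSum (u := fun i : { i // i ∉ F } => u i)
    (fun k n => (hu k n).subtype _) _ (fun x => ?_) k n
  have h5 := (Finset.hasSum_compl_iff (f := fun i => u i x) F (a := s x - ∑ i ∈ F, u i x)).2
    (by rw [sub_add_cancel, hs]; exact (hsum x).hasSum)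
  have h6 : (s - ∑ i ∈ F, u i) x = s x - ∑ i ∈ F, u i x := by
    simp
  rw [h6]
  exact h5

section Expansion

variable {θ : ℝ} (hθ : 0 < θ)

/-- The coefficients `(2πθ)⁻¹ ∫ conj(f_mn) g` of a Schwartz function. -/
noncomputable def coeffS (g : 𝓢(Plane, ℂ)) (m n : ℕ) : ℂ :=
  1 / ((2 * Real.pi * θ : ℝ) : ℂ) * pair (matrixBasis hθ n m) g

/-- The coefficients of a Schwartz function decay rapidly. -/
theorem exists_norm_coeffS_le (g : 𝓢(Plane, ℂ)) (r : ℕ) :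
    ∃ C : ℝ, 0 ≤ C ∧ ∀ m n, ‖coeffS hθ g m n‖ * wt m n ^ r ≤ C := by
  -- powers of the number operators on both sides move from the basis to `g`
  let K : Module.End ℂ 𝓢(Plane, ℂ) :=
    ((θ : ℂ)⁻¹ * (θ : ℂ)⁻¹) • (zbarOp (-θ) * zOp (-θ) * zOp θ * zbarOp θ)
  have hθ' : (θ : ℂ) ≠ 0 := mod_cast hθ.ne'
  have hK : ∀ m n g, pair (matrixBasis hθ n m) (K g) =
      (wt m n : ℂ) * pair (matrixBasis hθ n m) g := by
    intro m n g
    have e1 : zOp θ (zbarOp θ (matrixBasis hθ n m)) = (θ * (n + 1 : ℕ) : ℂ) • matrixBasis hθ n m := by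
      rw [zbarOp_matrixBasis, map_smul, zOp_matrixBasis, smul_smul, lad_mul_self hθ,
        Nat.add_sub_cancel]
    have e2 : zbarOp (-θ) (zOp (-θ) (matrixBasis hθ n m)) =
        (θ * (m + 1 : ℕ) : ℂ) • matrixBasis hθ n m := by
      rw [zOp_neg_matrixBasis, map_smul, zbarOp_neg_matrixBasis, smul_smul, lad_mul_self hθ,
        Nat.add_sub_cancel]
    have s1 : ∀ f g, pair f (zOp θ g) = pair (zOp (-θ) f) g := fun f g => by
      rw [pair_zOp, neg_neg]
    have s2 : ∀ f g, pair f (zbarOp θ g) = pair (zbarOp (-θ) f) g := fun f g => by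
      rw [pair_zbarOp, neg_neg]
    simp only [K, LinearMap.smul_apply, Module.End.mul_apply, pair_smul_right]
    rw [← pair_zbarOp, ← pair_zOp, e1, s1, s2, map_smul, map_smul, e2, pair_smul_left,
      pair_smul_left, wt]
    push_cast
    field_simp
    ring
  have hKj : ∀ j m n g, pair (matrixBasis hθ n m) ((K ^ j) g) =
      (wt m n : ℂ) ^ j * pair (matrixBasis hθ n m) g := by
    intro j m n
    induction j with
    | zero => intro g; simp
    | succ j ih => intro g; rw [pow_succ, Module.End.mul_apply, ih, hK]; ring
  obtain ⟨C, r₀, hC, hb⟩ := polyGrowth_seminorm hθ 0 0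
  have hw : ∀ m n, wt n m = wt m n := fun m n => mul_comm _ _
  let c := ‖1 / ((2 * Real.pi * θ : ℝ) : ℂ)‖
  let N := lpSeminorm 1 ((K ^ (r + r₀)) g)
  have hN : 0 ≤ N := apply_nonneg _ _
  refine ⟨c * (C * N), by positivity, fun m n => ?_⟩
  have hpos := wt_pos m n
  have h1 : ‖pair (matrixBasis hθ n m) ((K ^ (r + r₀)) g)‖ ≤ C * wt m n ^ r₀ * N := by
    rw [pair]
    refine (norm_integral_le_integral_norm _).trans ?_
    simp only [N, lpSeminorm_one]
    rw [← integral_const_mul]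
    refine integral_mono (integrable_mul_schwartz _ _).norm
      ((SchwartzMap.integrable _).norm.const_mul _) fun x => ?_
    simp only [norm_mul]
    gcongr
    rw [← hw]
    exact ((matrixBasis hθ n m).norm_le_seminorm ℂ x).trans (hb n m)
  rw [hKj, norm_mul, norm_pow, norm_real, Real.norm_of_nonneg hpos.le, pow_add] at h1
  rw [coeffS, norm_mul, mul_assoc]
  refine mul_le_mul_of_nonneg_left ?_ (norm_nonneg _)
  refine le_of_mul_le_mul_right (a := wt m n ^ r₀) ?_ (by positivity)
  calc _ = wt m n ^ r * wt m n ^ r₀ * ‖pair (matrixBasis hθ n m) g‖ := by ring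
    _ ≤ _ := h1
    _ = _ := by ring

theorem summable_wt_inv_sq : Summable fun p : ℕ × ℕ => (wt p.1 p.2 ^ 2)⁻¹ := by
  have h : Summable fun n : ℕ => ((1 + n : ℝ) ^ 2)⁻¹ := by
    have := (summable_nat_add_iff 1).2 (Real.summable_nat_pow_inv.2 (one_lt_two))
    refine this.congr fun n => ?_
    push_cast; ring_nf
  refine (h.mul_of_nonneg h (fun n => by positivity) (fun n => by positivity)).congr fun p => ?_
  simp only [wt]
  rw [← mul_inv, mul_pow]

theorem two_pi_theta_ne_zero {θ : ℝ} (hθ : 0 < θ) : ((2 * Real.pi * θ : ℝ) : ℂ) ≠ 0 := by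
  rw [ofReal_ne_zero]
  have := Real.pi_pos
  positivity

/-- Every Schwartz function is the sum of its expansion in the matrix basis, in the topology of
the Schwartz space. -/
theorem hasSum_matrixBasis (g : 𝓢(Plane, ℂ)) :
    HasSum (fun p : ℕ × ℕ => coeffS hθ g p.1 p.2 • matrixBasis hθ p.1 p.2) g := by
  obtain ⟨s, hs⟩ := exists_hasSum_of_summable_seminorm
    (u := fun p : ℕ × ℕ => coeffS hθ g p.1 p.2 • matrixBasis hθ p.1 p.2) (by
      intro k n
      obtain ⟨C, r, hC, hb⟩ := polyGrowth_seminorm hθ k n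
      obtain ⟨D, hD, hd⟩ := exists_norm_coeffS_le hθ g (r + 2)
      refine Summable.of_nonneg_of_le (fun p => apply_nonneg _ _) (fun p => ?_)
        (summable_wt_inv_sq.mul_left (C * D))
      have hpos := wt_pos p.1 p.2
      rw [map_smul_eq_mul, ← div_eq_mul_inv, le_div_iff₀ (by positivity)]
      calc _ ≤ ‖coeffS hθ g p.1 p.2‖ * (C * wt p.1 p.2 ^ r) * wt p.1 p.2 ^ 2 := by
            gcongr; exact hb _ _
        _ = C * (‖coeffS hθ g p.1 p.2‖ * wt p.1 p.2 ^ (r + 2)) := by rw [pow_add]; ring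
        _ ≤ _ := by gcongr; exact hd _ _)
  have h0 : s - g = 0 := by
    refine eq_zero_of_pair_matrixBasis hθ fun m n => ?_
    have h1 : HasSum _ (toDist (matrixBasis hθ m n) s) :=
      hs.map (toDist (matrixBasis hθ m n)) (map_continuous _)
    have h2 := h1.unique (hasSum_single (n, m) fun p hp => by
      simp only [Function.comp_apply, toDist_apply, pair_smul_right, pair_matrixBasis]
      rw [if_neg, mul_zero]
      rintro ⟨rfl, rfl⟩
      exact hp rfl)
    simp only [Function.comp_apply, toDist_apply, pair_smul_right, pair_matrixBasis, and_self,
      if_true, coeffS] at h2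
    rw [pair_sub_right, h2]
    have := two_pi_theta_ne_zero hθ
    push_cast at this ⊢
    field_simp
    ring
  rwa [sub_eq_zero.1 h0] at hs

/-- The expansion of `g` may be paired termwise with a tempered distribution, by continuity. -/
theorem hasSum_coeffS_mul (D : Dist) (g : 𝓢(Plane, ℂ)) :
    HasSum (fun p : ℕ × ℕ => coeffS hθ g p.1 p.2 * D (matrixBasis hθ p.1 p.2)) (D g) := by
  have h := (hasSum_matrixBasis hθ g).map D (map_continuous D)
  simpa [Function.comp_def] using h

theorem coeffMatrix_apply (a : Dist) (m n : ℕ) :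
    coeffMatrix hθ a m n = 1 / ((2 * Real.pi * θ : ℝ) : ℂ) * a (matrixBasis hθ n m) := by
  rw [coeffMatrix, Matrix.of_apply, conjS_matrixBasis]

theorem isExpansion_coeffMatrix (a : Dist) : IsExpansion hθ (coeffMatrix hθ a) a := by
  rw [IsExpansion, HasSum, PointwiseConvergenceCLM.tendsto_iff_forall_tendsto]
  intro g
  have h := (Equiv.prodComm ℕ ℕ).hasSum_iff.2 (hasSum_coeffS_mul hθ a g)
  refine Filter.Tendsto.congr (fun F => ?_) h
  have h1 : ∀ u : ℕ × ℕ → Dist, (∑ i ∈ F, u i) g = ∑ i ∈ F, u i g := by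
    intro u
    induction F using Finset.induction_on with
    | empty => simp
    | insert i F hi ih => rw [Finset.sum_insert hi, Finset.sum_insert hi, add_apply, ih]
  rw [h1]
  refine Finset.sum_congr rfl fun p _ => ?_
  simp only [Function.comp_apply, Equiv.prodComm_apply, Prod.fst_swap, Prod.snd_swap, coeffS,
    smul_apply, toDist_apply, coeffMatrix_apply, smul_eq_mul]
  ring

end Expansion


/-! ### Derivatives in the matrix basis -/

section Derivatives

variable {θ : ℝ} (hθ : 0 < θ)

theorem lineDeriv_dist_apply (a : Dist) (i : Fin 2) (g : 𝓢(Plane, ℂ)) :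
    (∂_{dir i} a) g = -a (coordDeriv i g) := by
  rw [TemperedDistribution.lineDerivOp_apply_apply, map_neg, coordDeriv_eq]

theorem partialMinus_apply (a : Dist) (g : 𝓢(Plane, ℂ)) :
    partialMinus a g = a (coordDeriv 1 g) - a (coordDeriv 0 g) := by
  rw [partialMinus, sub_apply, lineDeriv_dist_apply, lineDeriv_dist_apply]
  ring

theorem partialPlus_apply (a : Dist) (g : 𝓢(Plane, ℂ)) :
    partialPlus a g = -a (coordDeriv 1 g) - a (coordDeriv 0 g) := by
  rw [partialPlus, add_apply, lineDeriv_dist_apply, lineDeriv_dist_apply]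
  ring

theorem conj_lam : conj lam = (1 - I) / (Real.sqrt 2 : ℂ) := by
  simp [lam, sub_eq_add_neg]

theorem sqrt_div_eq_lad {θ : ℝ} (hθ : 0 < θ) (k : ℕ) :
    (Real.sqrt (k / θ) : ℂ) = lad θ k / θ := by
  rw [lad, ← ofReal_div]
  congr 1
  rw [show (k : ℝ) / θ = (θ * k) / θ ^ 2 by field_simp, Real.sqrt_div (by positivity),
    Real.sqrt_sq hθ.le]

theorem coeffMatrix_partialMinus (a : Dist) (m n : ℕ) :
    coeffMatrix hθ (partialMinus a) m n =
      coeffMatrix hθ a (m + 1) n * lam * Real.sqrt ((m + 1) / θ)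
        + coeffMatrix hθ a m (n + 1) * conj lam * Real.sqrt ((n + 1) / θ)
        - coeffMatrix hθ a (m - 1) n * conj lam * Real.sqrt (m / θ)
        - coeffMatrix hθ a m (n - 1) * lam * Real.sqrt (n / θ) := by
  have h1 := sqrt_div_eq_lad hθ (m + 1)
  have h2 := sqrt_div_eq_lad hθ (n + 1)
  push_cast at h1 h2
  have : (θ : ℂ) ≠ 0 := mod_cast hθ.ne'
  rw [h1, h2, sqrt_div_eq_lad hθ m, sqrt_div_eq_lad hθ n, conj_lam, lam]
  simp only [coeffMatrix_apply, partialMinus_apply, coordDeriv_zero_eq hθ.ne',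
    coordDeriv_one_eq hθ.ne', zOp_matrixBasis, zOp_neg_matrixBasis, zbarOp_matrixBasis,
    zbarOp_neg_matrixBasis, map_smul, map_add, map_sub, smul_eq_mul]
  ring

theorem coeffMatrix_partialPlus (a : Dist) (m n : ℕ) :
    coeffMatrix hθ (partialPlus a) m n =
      coeffMatrix hθ a (m + 1) n * conj lam * Real.sqrt ((m + 1) / θ)
        + coeffMatrix hθ a m (n + 1) * lam * Real.sqrt ((n + 1) / θ)
        - coeffMatrix hθ a (m - 1) n * lam * Real.sqrt (m / θ)
        - coeffMatrix hθ a m (n - 1) * conj lam * Real.sqrt (n / θ) := by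
  have h1 := sqrt_div_eq_lad hθ (m + 1)
  have h2 := sqrt_div_eq_lad hθ (n + 1)
  push_cast at h1 h2
  have : (θ : ℂ) ≠ 0 := mod_cast hθ.ne'
  rw [h1, h2, sqrt_div_eq_lad hθ m, sqrt_div_eq_lad hθ n, conj_lam, lam]
  simp only [coeffMatrix_apply, partialPlus_apply, coordDeriv_zero_eq hθ.ne',
    coordDeriv_one_eq hθ.ne', zOp_matrixBasis, zOp_neg_matrixBasis, zbarOp_matrixBasis,
    zbarOp_neg_matrixBasis, map_smul, map_add, map_sub, smul_eq_mul]
  ring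

end Derivatives

/-! ### Positivity of a distribution and of its coefficient matrix -/

section Positivity

variable {θ : ℝ} (hθ : 0 < θ)

theorem norm_pair_moyalProd_le (θ : ℝ) (g f h : 𝓢(Plane, ℂ)) :
    ‖pair g (moyalProd θ f h)‖ ≤
      lpSeminorm 1 g * (1 / (Real.pi * θ) ^ 2 * (lpSeminorm 1 f * lpSeminorm 1 h)) := by
  rw [pair]
  refine (norm_integral_le_integral_norm _).trans ?_
  rw [lpSeminorm_one g, ← integral_mul_const]
  refine integral_mono (integrable_mul_schwartz _ _).norm (g.integrable.norm.mul_const _)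
    fun x => ?_
  simp only [norm_mul]
  gcongr
  exact norm_moyalProd_le θ f h x

/-- The functional `f ↦ ∫ g (f ⋆ h)` on the Schwartz space. -/
noncomputable def pairMoyal (θ : ℝ) (g h : 𝓢(Plane, ℂ)) : 𝓢(Plane, ℂ) →ₗ[ℂ] ℂ where
  toFun f := pair g (moyalProd θ f h)
  map_add' f f' := by rw [moyalProd_add_left, pair_add_right]
  map_smul' c f := by rw [moyalProd_smul_left, pair_smul_right]; rfl

theorem pairMoyal_apply (θ : ℝ) (g h f : 𝓢(Plane, ℂ)) :
    pairMoyal θ g h f = pair g (moyalProd θ f h) := rfl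

theorem continuous_pairMoyal (θ : ℝ) (g h : 𝓢(Plane, ℂ)) : Continuous (pairMoyal θ g h) := by
  refine continuous_of_continuousAt_zero (pairMoyal θ g h) ?_
  rw [ContinuousAt, map_zero]
  let C := lpSeminorm 1 g * (1 / (Real.pi * θ) ^ 2)
  have h1 : Filter.Tendsto (fun f : 𝓢(Plane, ℂ) => C * (‖SchwartzMap.toLpCLM ℂ ℂ 1
      (volume : Measure Plane) f‖ * lpSeminorm 1 h)) (nhds 0) (nhds 0) := by
    have h2 : Continuous (fun f : 𝓢(Plane, ℂ) => C * (‖SchwartzMap.toLpCLM ℂ ℂ 1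
      (volume : Measure Plane) f‖ * lpSeminorm 1 h)) := by fun_prop
    have h3 := h2.tendsto 0
    rwa [map_zero, norm_zero, zero_mul, mul_zero] at h3
  refine squeeze_zero_norm (fun f => ?_) h1
  refine (norm_pair_moyalProd_le θ g f h).trans (le_of_eq ?_)
  rw [← mul_assoc]
  rfl

/-- The coefficients of a Moyal product are given by matrix multiplication. -/
theorem hasSum_coeffS_moyalProd (f h : 𝓢(Plane, ℂ)) (k m : ℕ) :
    HasSum (fun l => coeffS hθ f k l * coeffS hθ h l m) (coeffS hθ (moyalProd θ f h) k m) := by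
  have hc := two_pi_theta_ne_zero hθ
  have step1 : ∀ k' l, pair (matrixBasis hθ m k) (moyalProd θ (matrixBasis hθ k' l) h) =
      if k = k' then (2 * Real.pi * θ : ℂ) * coeffS hθ h l m else 0 := by
    intro k' l
    have h1 := (hasSum_matrixBasis hθ h).map (pairMoyal (-θ) (matrixBasis hθ m k)
      (matrixBasis hθ k' l)) (continuous_pairMoyal _ _ _)
    have h2 := h1.unique (hasSum_single (l, m) fun p hp => by
      simp only [Function.comp_apply, map_smul, pairMoyal_apply]
      rw [← moyalProd_swap, moyalProd_matrixBasis]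
      by_cases hl : l = p.1
      · rw [if_pos hl, pair_matrixBasis, if_neg, smul_zero]
        rintro ⟨hm, -⟩
        exact hp (Prod.ext hl.symm hm.symm)
      · rw [if_neg hl, pair_zero_right, smul_zero])
    simp only [Function.comp_apply, map_smul, pairMoyal_apply] at h2
    rw [← moyalProd_swap, ← moyalProd_swap, moyalProd_matrixBasis, if_pos rfl,
      pair_matrixBasis] at h2
    rw [h2]
    by_cases hk : k = k'
    · simp [hk, mul_comm]
    · simp [hk]
  have h3 := (hasSum_matrixBasis hθ f).map (pairMoyal θ (matrixBasis hθ m k) h)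
    (continuous_pairMoyal _ _ _)
  have hinj : Function.Injective (fun l : ℕ => (k, l)) := fun l l' h => (Prod.ext_iff.1 h).2
  rw [← hinj.hasSum_iff] at h3
  · have h4 := h3.mul_left (1 / ((2 * Real.pi * θ : ℝ) : ℂ))
    refine (congrArg (fun u => HasSum u _) (funext fun l => ?_)).mpr h4
    simp only [Function.comp_apply, map_smul, pairMoyal_apply, step1,
      if_true, smul_eq_mul]
    push_cast at hc ⊢
    field_simp
  · rintro ⟨k', l⟩ hp
    simp only [Function.comp_apply, map_smul, pairMoyal_apply, step1]
    rw [if_neg, smul_zero]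
    rintro rfl
    exact hp ⟨l, rfl⟩

theorem pair_conjS (f g : 𝓢(Plane, ℂ)) : pair (conjS f) (conjS g) = conj (pair f g) := by
  rw [pair, pair, ← integral_conj]
  simp [conjS_apply]

theorem coeffS_conjS (f : 𝓢(Plane, ℂ)) (m n : ℕ) :
    coeffS hθ (conjS f) m n = conj (coeffS hθ f n m) := by
  rw [coeffS, coeffS, ← conjS_matrixBasis, pair_conjS, map_mul, map_div₀, map_one, conj_ofReal]

theorem apply_matrixBasis (b : Dist) (m n : ℕ) :
    b (matrixBasis hθ m n) = ((2 * Real.pi * θ : ℝ) : ℂ) * coeffMatrix hθ b n m := by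
  rw [coeffMatrix_apply, ← mul_assoc, mul_one_div_cancel (two_pi_theta_ne_zero hθ), one_mul]

theorem two_pi_theta_nonneg {θ : ℝ} (hθ : 0 < θ) : (0 : ℂ) ≤ ((2 * Real.pi * θ : ℝ) : ℂ) := by
  rw [← ofReal_zero, real_le_real]
  have := Real.pi_pos
  positivity

theorem moyalProd_sum_left {ι : Type*} (θ : ℝ) (s : Finset ι) (u : ι → 𝓢(Plane, ℂ))
    (g : 𝓢(Plane, ℂ)) : moyalProd θ (∑ i ∈ s, u i) g = ∑ i ∈ s, moyalProd θ (u i) g := by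
  classical
  induction s using Finset.induction_on with
  | empty => simpa using moyalProd_smul_left θ 0 0 g
  | insert i s hi ih => rw [Finset.sum_insert hi, Finset.sum_insert hi, moyalProd_add_left, ih]

theorem moyalProd_sum_right {ι : Type*} (θ : ℝ) (s : Finset ι) (u : ι → 𝓢(Plane, ℂ))
    (g : 𝓢(Plane, ℂ)) : moyalProd θ g (∑ i ∈ s, u i) = ∑ i ∈ s, moyalProd θ g (u i) := by
  rw [moyalProd_swap, moyalProd_sum_left]
  exact Finset.sum_congr rfl fun i _ => (moyalProd_swap θ g (u i)).symm

theorem conjS_sum {ι : Type*} (s : Finset ι) (u : ι → 𝓢(Plane, ℂ)) :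
    conjS (∑ i ∈ s, u i) = ∑ i ∈ s, conjS (u i) := by
  classical
  induction s using Finset.induction_on with
  | empty => ext x; simp [conjS_apply]
  | insert i s hi ih => rw [Finset.sum_insert hi, Finset.sum_insert hi, conjS_add, ih]

/-- On finite combinations of the first column of the basis the form `φ ↦ ⟨b, φ ⋆ φ̄⟩` is the
quadratic form of the coefficient matrix. -/
theorem apply_moyalProd_conjS_column (b : Dist) (x : ℕ →₀ ℂ) :
    b (moyalProd θ (x.sum fun k c => c • matrixBasis hθ k 0)
      (conjS (x.sum fun k c => c • matrixBasis hθ k 0))) =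
    ((2 * Real.pi * θ : ℝ) : ℂ) * x.sum fun i xi => x.sum fun j xj =>
      star xi * coeffMatrix hθ b i j * xj := by
  simp only [Finsupp.sum, conjS_sum, conjS_smul, conjS_matrixBasis, moyalProd_sum_left,
    moyalProd_sum_right, moyalProd_smul_left, moyalProd_smul_right, moyalProd_matrixBasis,
    if_true, map_sum, map_smul, apply_matrixBasis, smul_eq_mul, Finset.mul_sum]
  refine Finset.sum_congr rfl fun i _ => Finset.sum_congr rfl fun j _ => ?_
  rw [starRingEnd_apply]
  ring

/-- A complex matrix with nonnegative quadratic form is Hermitian. -/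
theorem posSemidef_of_forall_nonneg {M : Matrix ℕ ℕ ℂ}
    (h : ∀ x : ℕ →₀ ℂ, 0 ≤ x.sum fun i xi => x.sum fun j xj => star xi * M i j * xj) :
    M.PosSemidef := by
  refine ⟨?_, h⟩
  have key : ∀ i j (c : ℂ), (M i i + c * M i j + conj c * M j i + conj c * c * M j j).im = 0 := by
    intro i j c
    have h1 := (Complex.le_def.1 (h (Finsupp.single i 1 + Finsupp.single j c))).2
    rw [zero_im] at h1
    rw [h1]
    congr 1
    rw [Finsupp.sum_add_index' (by simp) (by
      intros; simp only [star_add, add_mul, Finsupp.sum_add]),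
      Finsupp.sum_single_index (by simp), Finsupp.sum_single_index (by simp),
      Finsupp.sum_add_index' (by simp) (by intros; ring),
      Finsupp.sum_add_index' (by simp) (by intros; ring),
      Finsupp.sum_single_index (by simp), Finsupp.sum_single_index (by simp),
      Finsupp.sum_single_index (by simp), Finsupp.sum_single_index (by simp)]
    simp
    ring
  have hd : ∀ i, (M i i).im = 0 := fun i => by simpa using key i i 0
  ext i j
  rw [Matrix.conjTranspose_apply]
  have h1 := key i j 1
  have h2 := key i j I
  have hi := hd i
  have hj := hd j
  simp at h1 h2
  rw [hi, hj] at h1 h2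
  apply Complex.ext
  · simp; linarith
  · simp; linarith

theorem sum_range_nonneg {M : Matrix ℕ ℕ ℂ} (hM : M.PosSemidef) (N : ℕ) (v : ℕ → ℂ) :
    0 ≤ ∑ i ∈ Finset.range N, ∑ j ∈ Finset.range N, star (v i) * M i j * v j := by
  classical
  have h := hM.2 (Finsupp.onFinset (Finset.range N) (fun k => if k ∈ Finset.range N then v k else 0)
    fun k hk => by by_contra hn; simp [hn] at hk)
  rw [Finsupp.onFinset_sum _ (by simp)] at h
  refine h.trans_eq (Finset.sum_congr rfl fun i hi => ?_)
  rw [Finsupp.onFinset_sum _ (by simp)]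
  exact Finset.sum_congr rfl fun j hj => by rw [if_pos hi, if_pos hj]

/-- A tempered distribution `b` satisfies `⟨b, φ ⋆ φ̄⟩ ≥ 0` for all Schwartz functions `φ` if and
only if its coefficient matrix is positive semidefinite. -/
theorem forall_apply_moyalProd_conjS_nonneg_iff (b : Dist) :
    (∀ φ : 𝓢(Plane, ℂ), 0 ≤ b (moyalProd θ φ (conjS φ))) ↔ (coeffMatrix hθ b).PosSemidef := by
  have hc : 0 < 2 * Real.pi * θ := by have := Real.pi_pos; positivity
  constructor
  · intro h
    refine posSemidef_of_forall_nonneg fun x => ?_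
    have h1 := h (x.sum fun k c => c • matrixBasis hθ k 0)
    rw [apply_moyalProd_conjS_column] at h1
    have hc' : (0 : ℂ) ≤ (((2 * Real.pi * θ)⁻¹ : ℝ) : ℂ) := by
      rw [← ofReal_zero, real_le_real]; positivity
    have h2 := mul_nonneg hc' h1
    rwa [← mul_assoc, ofReal_inv, inv_mul_cancel₀ (two_pi_theta_ne_zero hθ), one_mul] at h2
  · intro hM φ
    have h1 := hasSum_coeffS_mul hθ b (moyalProd θ φ (conjS φ))
    have hmono : Monotone fun N : ℕ => Finset.range N ×ˢ Finset.range N := fun N N' h =>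
      Finset.product_subset_product (Finset.range_mono h) (Finset.range_mono h)
    have h2 := h1.comp (Filter.tendsto_atTop_finset_of_monotone hmono fun p =>
      ⟨p.1 + p.2 + 1, by simp⟩)
    refine ge_of_tendsto' h2 fun N => ?_
    -- a truncation in both outer indices is a sum over `l` of values of the quadratic form
    have h3 : HasSum (fun l => ((2 * Real.pi * θ : ℝ) : ℂ) * ∑ m ∈ Finset.range N,
        ∑ k ∈ Finset.range N, star (coeffS hθ φ m l) * coeffMatrix hθ b m k * coeffS hθ φ k l)
        (∑ p ∈ Finset.range N ×ˢ Finset.range N,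
          coeffS hθ (moyalProd θ φ (conjS φ)) p.1 p.2 * b (matrixBasis hθ p.1 p.2)) := by
      have h4 := hasSum_sum (s := Finset.range N ×ˢ Finset.range N) fun (p : ℕ × ℕ) _ =>
        (hasSum_coeffS_moyalProd hθ φ (conjS φ) p.1 p.2).mul_right (b (matrixBasis hθ p.1 p.2))
      refine (congrArg (fun u => HasSum u _) (funext fun l => ?_)).mpr h4
      rw [Finset.sum_product_right, Finset.mul_sum]
      refine Finset.sum_congr rfl fun m _ => ?_
      rw [Finset.mul_sum]
      refine Finset.sum_congr rfl fun k _ => ?_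
      rw [coeffS_conjS, apply_matrixBasis, starRingEnd_apply]
      ring
    exact h3.nonneg fun l => mul_nonneg (two_pi_theta_nonneg hθ) (sum_range_nonneg hM N _)

end Positivity


/-! ### The operator `J[D, π(a)]` -/

theorem pair_neg_left (f g : 𝓢(Plane, ℂ)) : pair (-f) g = -pair f g := by
  rw [← neg_one_smul ℂ, pair_smul_left, neg_one_mul]

theorem pair_leftMul (θ : ℝ) (a : multiplierAlgebra θ) (f g : 𝓢(Plane, ℂ)) :
    pair (leftMul θ a f) g = (a : Dist) (moyalProd θ f g) :=
  leftProd_spec (a.2 f).1 g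

/-- The commutator of `∂ᵢ` with left multiplication by `a` is left multiplication by `∂ᵢ a`. -/
theorem pair_coordDeriv_leftMul_sub (θ : ℝ) (a : multiplierAlgebra θ) (i : Fin 2)
    (f g : 𝓢(Plane, ℂ)) :
    pair (coordDeriv i (leftMul θ a f) - leftMul θ a (coordDeriv i f)) g =
      (∂_{dir i} (a : Dist)) (moyalProd θ f g) := by
  rw [pair_sub_left, pair_coordDeriv, pair_leftMul, pair_leftMul, lineDeriv_dist_apply,
    coordDeriv_moyalProd, map_add]
  ring

theorem dirac_apply_zero (ψ : SchwartzSpinor) :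
    dirac ψ 0 = coordDeriv 0 (ψ 1) + coordDeriv 1 (ψ 1) := by
  ext x
  simp [dirac, derivOp, matOp, gamma, coordDeriv_eq]
  linear_combination (-(∂_{dir 0} (ψ 1)) x - (∂_{dir 1} (ψ 1)) x) * I_mul_I

theorem dirac_apply_one (ψ : SchwartzSpinor) :
    dirac ψ 1 = coordDeriv 0 (ψ 0) - coordDeriv 1 (ψ 0) := by
  ext x
  have h := congrArg (fun f : 𝓢(Plane, ℂ) => f x) ((coordDeriv 1).map_smul I (ψ 0))
  simp only [coordDeriv_eq, smul_apply, smul_eq_mul] at h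
  simp [dirac, derivOp, matOp, gamma, coordDeriv_eq, h]
  linear_combination (-(∂_{dir 0} (ψ 0)) x + (∂_{dir 1} (ψ 0)) x) * I_mul_I

theorem fundSymm_apply_zero (ψ : SchwartzSpinor) : fundSymm ψ 0 = -ψ 1 := by
  simp [fundSymm, matOp, gamma]

theorem fundSymm_apply_one (ψ : SchwartzSpinor) : fundSymm ψ 1 = -ψ 0 := by
  simp [fundSymm, matOp, gamma]

theorem causalCore_apply_zero (θ : ℝ) (a : multiplierAlgebra θ) (ψ : SchwartzSpinor) :
    causalCore θ a ψ 0 =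
      (coordDeriv 1 (leftMul θ a (ψ 0)) - leftMul θ a (coordDeriv 1 (ψ 0))) -
        (coordDeriv 0 (leftMul θ a (ψ 0)) - leftMul θ a (coordDeriv 0 (ψ 0))) := by
  have h : causalCore θ a ψ 0 =
      -(dirac (rep θ a ψ) 1 - leftMul θ a (dirac ψ 1)) := fundSymm_apply_zero _
  rw [h, dirac_apply_one, dirac_apply_one, map_sub]
  simp only [rep, LinearMap.compLeft_apply, Function.comp_apply]
  abel

theorem causalCore_apply_one (θ : ℝ) (a : multiplierAlgebra θ) (ψ : SchwartzSpinor) :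
    causalCore θ a ψ 1 =
      -(coordDeriv 0 (leftMul θ a (ψ 1)) - leftMul θ a (coordDeriv 0 (ψ 1))) -
        (coordDeriv 1 (leftMul θ a (ψ 1)) - leftMul θ a (coordDeriv 1 (ψ 1))) := by
  have h : causalCore θ a ψ 1 =
      -(dirac (rep θ a ψ) 0 - leftMul θ a (dirac ψ 0)) := fundSymm_apply_one _
  rw [h, dirac_apply_zero, dirac_apply_zero, map_add]
  simp only [rep, LinearMap.compLeft_apply, Function.comp_apply]
  abel

theorem inner_toLp (f g : 𝓢(Plane, ℂ)) :
    inner ℂ (SchwartzMap.toLpCLM ℂ ℂ 2 (volume : Measure Plane) f)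
      (SchwartzMap.toLpCLM ℂ ℂ 2 (volume : Measure Plane) g) = pair g (conjS f) := by
  refine (SchwartzMap.inner_toL2_toL2_eq f g).trans ?_
  simp only [RCLike.inner_apply, pair, conjS_apply]

/-- Up to the sign, `J[D, π(a)]` is the diagonal operator with entries `L(∂₋ a)`, `L(∂₊ a)`. -/
theorem inner_spinorEmb_causalCore (θ : ℝ) (a : multiplierAlgebra θ) (ψ : SchwartzSpinor) :
    inner ℂ (spinorEmb ψ) (spinorEmb (causalCore θ a ψ)) =
      -(partialMinus a (moyalProd θ (ψ 0) (conjS (ψ 0))) +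
        partialPlus a (moyalProd θ (ψ 1) (conjS (ψ 1)))) := by
  have h0 : ∀ χ : SchwartzSpinor, ∀ i,
      spinorEmb χ i = SchwartzMap.toLpCLM ℂ ℂ 2 (volume : Measure Plane) (χ i) := fun _ _ => rfl
  rw [PiLp.inner_apply, Fin.sum_univ_two, h0, h0, h0, h0, inner_toLp, inner_toLp,
    causalCore_apply_zero, causalCore_apply_one, pair_sub_left (_ - _),
    pair_sub_left (-_), pair_neg_left]
  simp only [pair_coordDeriv_leftMul_sub, partialMinus, partialPlus, sub_apply, add_apply]
  ring

/-- The two spinor components decouple, so the constraint on Schwartz spinors is the positivity of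
`∂₋ a` and of `∂₊ a` on all `φ ⋆ φ̄`. -/
theorem forall_inner_causalCore_iff {θ : ℝ} (hθ : 0 < θ) (a : multiplierAlgebra θ) :
    (∀ ψ, inner ℂ (spinorEmb ψ) (spinorEmb (causalCore θ a ψ)) ≤ 0) ↔
      (coeffMatrix hθ (partialMinus a)).PosSemidef ∧
        (coeffMatrix hθ (partialPlus a)).PosSemidef := by
  rw [← forall_apply_moyalProd_conjS_nonneg_iff, ← forall_apply_moyalProd_conjS_nonneg_iff]
  have hz : moyalProd θ 0 (conjS 0) = 0 := by simpa using moyalProd_smul_left θ 0 0 (conjS 0)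
  simp only [inner_spinorEmb_causalCore, neg_nonpos]
  constructor
  · intro h
    refine ⟨fun φ => ?_, fun φ => ?_⟩
    · simpa [hz] using h ![φ, 0]
    · simpa [hz] using h ![0, φ]
  · rintro ⟨h0, h1⟩ ψ
    exact add_nonneg (h0 _) (h1 _)

/-- A sesquilinear inequality for an operator passes to its closure, because the set of all pairs
`(u, v)` with `⟨u, v⟩ ≤ 0` is closed. -/
theorem forall_inner_closure_le_zero_iff {E : Type*} [NormedAddCommGroup E]
    [InnerProductSpace ℂ E] (T : E →ₗ.[ℂ] E) :
    (∀ φ : T.closure.domain, inner ℂ (φ : E) (T.closure φ) ≤ 0) ↔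
      ∀ φ : T.domain, inner ℂ (φ : E) (T φ) ≤ 0 := by
  constructor
  · intro h φ
    obtain ⟨hd, he⟩ := T.le_closure
    have h2 := he (x := φ) (y := ⟨φ, hd φ.2⟩) rfl
    rw [h2]
    exact h ⟨φ, hd φ.2⟩
  · intro h
    by_cases hc : T.IsClosable
    · intro φ
      have hcore : (T.graph : Set (E × E)) ⊆ {p : E × E | inner ℂ p.1 p.2 ≤ 0} := by
        intro p hp
        obtain ⟨y, hy, hTy⟩ := T.mem_graph_iff.1 hp
        rw [Set.mem_ofPred_eq, ← hy, ← hTy]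
        exact h y
      have hclosed : IsClosed {p : E × E | inner ℂ p.1 p.2 ≤ 0} :=
        isClosed_le (continuous_fst.inner continuous_snd) continuous_const
      have hφ := T.closure.mem_graph φ
      rw [← hc.graph_closure_eq_closure_graph] at hφ
      exact closure_minimal hcore hclosed hφ
    · rwa [LinearPMap.closure_def' hc]

/-- The causality constraint may be tested on Schwartz spinors. -/
theorem causalConstraint_iff_forall_schwartz (θ : ℝ) (a : multiplierAlgebra θ) :
    CausalConstraint θ a ↔
      ∀ ψ, inner ℂ (spinorEmb ψ) (spinorEmb (causalCore θ a ψ)) ≤ 0 := by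
  refine (forall_inner_closure_le_zero_iff _).trans ?_
  have hsymm : ∀ ψ, (LinearEquiv.ofInjective spinorEmb spinorEmb_injective).symm
      ⟨spinorEmb ψ, ⟨ψ, rfl⟩⟩ = ψ :=
    (LinearEquiv.ofInjective spinorEmb spinorEmb_injective).symm_apply_apply
  have happ : ∀ ψ, (spinorEmb ∘ₗ causalCore θ a ∘ₗ
      (LinearEquiv.ofInjective spinorEmb spinorEmb_injective).symm.toLinearMap)
        ⟨spinorEmb ψ, ⟨ψ, rfl⟩⟩ = spinorEmb (causalCore θ a ψ) := fun ψ =>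
    congrArg (fun χ => spinorEmb (causalCore θ a χ)) (hsymm ψ)
  constructor
  · intro h ψ
    rw [← happ]
    exact h ⟨spinorEmb ψ, ⟨ψ, rfl⟩⟩
  · rintro h ⟨_, ψ, rfl⟩
    have := h ψ
    rw [← happ] at this
    exact this

/-- Schwartz spinors are dense in the Hilbert space. -/
theorem denseRange_spinorEmb : DenseRange spinorEmb := by
  have h1 : DenseRange (SchwartzMap.toLpCLM ℂ ℂ 2 (volume : Measure Plane)) :=
    SchwartzMap.denseRange_toLpCLM (p := 2) ENNReal.ofNat_ne_top
  have h2 : DenseRange (Pi.map fun _ : Fin 2 =>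
      (SchwartzMap.toLpCLM ℂ ℂ 2 (volume : Measure Plane) : 𝓢(Plane, ℂ) → _)) :=
    DenseRange.piMap fun _ => h1
  exact (WithLp.toLp_surjective 2).denseRange.comp h2 (PiLp.continuous_toLp 2 _)

/-- For a bounded extension the constraint may be tested on Schwartz spinors. -/
theorem forall_inner_extension_iff {θ : ℝ} {a : multiplierAlgebra θ}
    {T : SpinorSpace →L[ℂ] SpinorSpace}
    (hT : ∀ ψ : SchwartzSpinor, T (spinorEmb ψ) = spinorEmb (causalCore θ a ψ)) :
    (∀ φ : SpinorSpace, inner ℂ φ (T φ) ≤ 0) ↔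
      ∀ ψ, inner ℂ (spinorEmb ψ) (spinorEmb (causalCore θ a ψ)) ≤ 0 := by
  refine ⟨fun h ψ => hT ψ ▸ h (spinorEmb ψ), fun h φ => ?_⟩
  refine denseRange_spinorEmb.induction_on (p := fun φ => inner ℂ φ (T φ) ≤ 0) φ
    (isClosed_le (continuous_id.inner T.continuous) continuous_const) fun ψ => ?_
  rw [hT]
  exact h ψ

end Moyal

theorem mainTheorem2 (θ : ℝ) (hθ : 0 < θ)
    (A : Submodule ℂ (multiplierAlgebra θ)) (hA : IsUnitization θ A)
    (a : multiplierAlgebra θ) (ha : a ∈ A)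
    (c α β : Matrix ℕ ℕ ℂ)
    (hc : c = coeffMatrix hθ a)
    (hα : α = coeffMatrix hθ (partialMinus a))
    (hβ : β = coeffMatrix hθ (partialPlus a)) :
    -- the expansions in the matrix basis
    (IsExpansion hθ c a ∧ IsExpansion hθ α (partialMinus a) ∧
      IsExpansion hθ β (partialPlus a)) ∧
    -- a) the shift formulas (for `m = 0` or `n = 0` the terms with index `-1` carry the factor 0)
    (∀ m n : ℕ,
      α m n = c (m + 1) n * lam * Real.sqrt ((m + 1) / θ)
        + c m (n + 1) * conj lam * Real.sqrt ((n + 1) / θ)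
        - c (m - 1) n * conj lam * Real.sqrt (m / θ)
        - c m (n - 1) * lam * Real.sqrt (n / θ)) ∧
    (∀ m n : ℕ,
      β m n = c (m + 1) n * conj lam * Real.sqrt ((m + 1) / θ)
        + c m (n + 1) * lam * Real.sqrt ((n + 1) / θ)
        - c (m - 1) n * lam * Real.sqrt (m / θ)
        - c m (n - 1) * conj lam * Real.sqrt (n / θ)) ∧
    -- b) the causality constraint
    (CausalConstraint θ a ↔ α.PosSemidef ∧ β.PosSemidef) ∧
    -- b) when `J[D, π(a)]` extends to a bounded operator `T` on the whole Hilbert space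
    (∀ T : SpinorSpace →L[ℂ] SpinorSpace,
      (∀ ψ : SchwartzSpinor, T (spinorEmb ψ) = spinorEmb (causalCore θ a ψ)) →
      ((∀ φ : SpinorSpace, inner ℂ φ (T φ) ≤ 0) ↔ α.PosSemidef ∧ β.PosSemidef)) ∧
    -- b) membership in the causal cone
    (a ∈ causalCone θ A ↔ IsHermitian (a : Dist) ∧ α.PosSemidef ∧ β.PosSemidef) := by
  subst hc hα hβ
  have hb := (causalConstraint_iff_forall_schwartz θ a).trans (forall_inner_causalCore_iff hθ a)
  refine ⟨⟨isExpansion_coeffMatrix hθ _, isExpansion_coeffMatrix hθ _,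
    isExpansion_coeffMatrix hθ _⟩, coeffMatrix_partialMinus hθ _, coeffMatrix_partialPlus hθ _,
    hb, fun T hT => (forall_inner_extension_iff hT).trans (forall_inner_causalCore_iff hθ a), ?_⟩
  exact ⟨fun h => ⟨h.2.1, hb.1 h.2.2⟩, fun h => ⟨ha, h.1, hb.2 h.2⟩⟩
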